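/- Fix a countably infinite set of variables and a signature $\Sigma$ with countably many function symbols and countably many predicate symbols of each arity $n\ge 0$. Terms are built from variables and function symbols as usual. Formulas are built from $\bot$, atoms $P(t_1,\dots,t_n)$ and equations $t_1=t_2$ with $\neg,\wedge,\vee,\to,\forall x,\exists x$; they are identified up to renaming of bound variables. $\mathrm{free}(\cdot)$ denotes the set of free variables, and $[x:=t]A$ denotes capture-avoiding substitution. *Proof system.* A sequent $\Gamma\vdash A$ consists of a finite set $\Gamma$ of formulas and a formula $A$; $\Gamma,A$ means $\Gamma\cup\{A\}$. The inference rules are: - without premises: $\Gamma,A\vdash A$; $\;\Gamma\vdash\neg\bot$; $\;\Gamma\vdash A\vee\neg A$; $\;\Gamma\vdash t=t$; - from $\Gamma\vdash\bot$ infer $\Gamma\vdash A$; - from $\Gamma\vdash A_1$ and $\Gamma\vdash A_2$ infer $\Gamma\vdash A_1\wedge A_2$; from $\Gamma\vdash A_1\wedge A_2$ infer $\Gamma\vdash A_i$ ($i=1,2$); - from $\Gamma\vdash A_i$ infer $\Gamma\vdash A_1\vee A_2$ ($i=1,2$); from $\Gamma\vdash A_1\vee A_2$, $\Gamma,A_1\vdash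 A_3$ and $\Gamma,A_2\vdash A_3$ infer $\Gamma\vdash A_3$; - from $\Gamma,A_1\vdash A_2$ infer $\Gamma\vdash A_1\to A_2$; from $\Gamma\vdash A_1\to A_2$ and $\Gamma\vdash A_1$ infer $\Gamma\vdash A_2$; - from $\Gamma\vdash A$ infer $\Gamma\vdash\forall x\,A$, if $x\notin\mathrm{free}(\Gamma)$; from $\Gamma\vdash\forall x\,A$ infer $\Gamma\vdash[x:=t]A$; - from $\Gamma\vdash[x:=t]A$ infer $\Gamma\vdash\exists x\,A$; from $\Gamma\vdash\exists x\,A_1$ and $\Gamma,A_1\vdash A_2$ infer $\Gamma\vdash A_2$, if $x\notin\mathrm{free}(\Gamma\cup\{A_2\})$; - from $\Gamma\vdash t_1=t_2$ and $\Gamma\vdash[x:=t_1]A$ infer $\Gamma\vdash[x:=t_2]A$; - in both directions, between $\Gamma\vdash B$ and $\Gamma\vdash B'$ for the pairs $(B,B')$: $(\neg\neg A,\;A)$, $(\neg(A_1\wedge A_2),\;\neg A_1\vee\neg A_2)$, $(\neg(A_1\vee A_2),\;\neg A_1\wedge\neg A_2)$, $(\neg(A_1\to A_2),\;A_1\wedge\neg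 A_2)$, $(\neg\forall x\,A,\;\exists x\,\neg A)$, $(\neg\exists x\,A,\;\forall x\,\neg A)$. A sequent is provable if it is the last entry of a finite sequence of sequents each of which is the conclusion of an instance of a rule whose premises occur earlier in the sequence. *Semantics.* The truth values are $\mathsf t$ (true), $\mathsf f$ (false) and $\mathsf b$ (both). A structure consists of a non-empty domain $U$, a function $U^n\to U$ for each $n$-ary function symbol, a function $U^n\to\{\mathsf t,\mathsf f,\mathsf b\}$ for each $n$-ary predicate symbol, and a function $\mathrm{eq}:U\times U\to\{\mathsf t,\mathsf f,\mathsf b\}$ such that $\mathrm{eq}(d,d)\in\{\mathsf t,\mathsf b\}$ for all $d$ and $\mathrm{eq}(d,d')=\mathsf f$ for all $d\ne d'$. Given an assignment of elements of $U$ to the variables, terms and atoms are evaluated as usual, equations by $\mathrm{eq}$, and $\bot$ has value $\mathsf f$. Order the values by $\mathsf f<\mathsf b<\mathsf t$. Then $\neg$ exchanges $\mathsf t$ and $\mathsf f$ and fixes $\mathsf b$; $\wedge$ and $\vee$ are minimum and maximum; $A_1\to A_2$ has value $\mathsf t$ if $A_1$ has value $\mathsf f$, and the value of $A_2$ otherwise;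 $\forall x\,A$ and $\exists x\,A$ have as value the minimum and the maximum of the values of $A$ as the value of $x$ ranges over $U$. We write $\Gamma\models A$ if, for every structure and every assignment, some formula in $\Gamma$ has value $\mathsf f$ or $A$ has value $\mathsf t$ or $\mathsf b$. **Theorem.** For every finite set $\Gamma$ of formulas and every formula $A$, the sequent $\Gamma\vdash A$ is provable if and only if $\Gamma\models A$. -/

import Mathlib

universe u v w

namespace LPif

/-! ### Language

A signature is a first-order language `L` (function and predicate symbols of each arity); the
variable symbols are the natural numbers, and the terms over the signature are `L.Term ℕ`.

Formulas are taken up to renaming of bound variables.  They are represented in the locally nameless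
style of Mathlib's `BoundedFormula`: in a term of type `L.Term (ℕ ⊕ Fin n)`, `Sum.inl x` is the
variable symbol `x` (a free occurrence), and `Sum.inr i` refers to the `i`-th enclosing quantifier,
counted from the outside. -/

/-- Formulas in the scope of `n` further quantifiers. -/
inductive PreFormula (L : FirstOrder.Language.{u, v}) : ℕ → Type (max u v)
  | falsum {n : ℕ} : PreFormula L n
  | pred {n k : ℕ} (P : L.Relations k) (ts : Fin k → L.Term (ℕ ⊕ Fin n)) : PreFormula L n
  | equal {n : ℕ} (t₁ t₂ : L.Term (ℕ ⊕ Fin n)) : PreFormula L n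
  | neg {n : ℕ} (A : PreFormula L n) : PreFormula L n
  | conj {n : ℕ} (A₁ A₂ : PreFormula L n) : PreFormula L n
  | disj {n : ℕ} (A₁ A₂ : PreFormula L n) : PreFormula L n
  | impl {n : ℕ} (A₁ A₂ : PreFormula L n) : PreFormula L n
  | all {n : ℕ} (A : PreFormula L (n + 1)) : PreFormula L n
  | ex {n : ℕ} (A : PreFormula L (n + 1)) : PreFormula L n

/-- The formulas over the signature `L`, up to renaming of bound variables. -/
abbrev Formula (L : FirstOrder.Language.{u, v}) := PreFormula L 0

noncomputable instance (L : FirstOrder.Language.{u, v}) : DecidableEq (Formula L) := Classical.decEq _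

namespace PreFormula

variable {L : FirstOrder.Language.{u, v}}

/-- Replace the variable symbol `x` by a reference to a new outermost quantifier. -/
def closeVar (x : ℕ) {n : ℕ} : ℕ ⊕ Fin n → ℕ ⊕ Fin (n + 1)
  | Sum.inl y => if y = x then Sum.inr 0 else Sum.inl y
  | Sum.inr i => Sum.inr i.succ

/-- Bind the free occurrences of `x` by a new outermost quantifier (not yet written). -/
def close (x : ℕ) : {n : ℕ} → PreFormula L n → PreFormula L (n + 1)
  | _, falsum => falsum
  | _, pred P ts => pred P fun i => (ts i).relabel (closeVar x)
  | _, equal t₁ t₂ => equal (t₁.relabel (closeVar x)) (t₂.relabel (closeVar x))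
  | _, neg A => neg (close x A)
  | _, conj A₁ A₂ => conj (close x A₁) (close x A₂)
  | _, disj A₁ A₂ => disj (close x A₁) (close x A₂)
  | _, impl A₁ A₂ => impl (close x A₁) (close x A₂)
  | _, all A => all (close x A)
  | _, ex A => ex (close x A)

/-- What the substitution of `t` for `x` puts in place of a variable. -/
def substVar (x : ℕ) (t : L.Term ℕ) {n : ℕ} : ℕ ⊕ Fin n → L.Term (ℕ ⊕ Fin n)
  | Sum.inl y => if y = x then t.relabel Sum.inl else FirstOrder.Language.Term.var (Sum.inl y)
  | Sum.inr i => FirstOrder.Language.Term.var (Sum.inr i)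

/-- `subst x t A` is `[x := t] A`; no variable of `t` can be captured, since bound variables are
nameless. -/
def subst (x : ℕ) (t : L.Term ℕ) : {n : ℕ} → PreFormula L n → PreFormula L n
  | _, falsum => falsum
  | _, pred P ts => pred P fun i => (ts i).subst (substVar x t)
  | _, equal t₁ t₂ => equal (t₁.subst (substVar x t)) (t₂.subst (substVar x t))
  | _, neg A => neg (subst x t A)
  | _, conj A₁ A₂ => conj (subst x t A₁) (subst x t A₂)
  | _, disj A₁ A₂ => disj (subst x t A₁) (subst x t A₂)
  | _, impl A₁ A₂ => impl (subst x t A₁) (subst x t A₂)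
  | _, all A => all (subst x t A)
  | _, ex A => ex (subst x t A)

/-- The free variables of a formula. -/
def free : {n : ℕ} → PreFormula L n → Set ℕ
  | _, falsum => ∅
  | _, pred _ ts => {x | ∃ i, x ∈ (ts i).varFinsetLeft}
  | _, equal t₁ t₂ => {x | x ∈ t₁.varFinsetLeft ∨ x ∈ t₂.varFinsetLeft}
  | _, neg A => free A
  | _, conj A₁ A₂ => free A₁ ∪ free A₂
  | _, disj A₁ A₂ => free A₁ ∪ free A₂
  | _, impl A₁ A₂ => free A₁ ∪ free A₂
  | _, all A => free A
  | _, ex A => free A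

end PreFormula

namespace Formula

variable {L : FirstOrder.Language.{u, v}}

/-- The formula `t₁ = t₂`. -/
def eq (t₁ t₂ : L.Term ℕ) : Formula L :=
  PreFormula.equal (t₁.relabel Sum.inl) (t₂.relabel Sum.inl)

/-- The formula `∀ x, A`. -/
def forall_ (x : ℕ) (A : Formula L) : Formula L := PreFormula.all (A.close x)

/-- The formula `∃ x, A`. -/
def exists_ (x : ℕ) (A : Formula L) : Formula L := PreFormula.ex (A.close x)

end Formula

/-! ### Proof system -/

/-- A sequent `Γ ⊢ A`. -/
structure Sequent (L : FirstOrder.Language.{u, v}) where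
  left : Finset (Formula L)
  right : Formula L

section ProofSystem

variable {L : FirstOrder.Language.{u, v}}

/-- The free variables of a finite set of formulas. -/
def freeVars (Γ : Finset (Formula L)) : Set ℕ := ⋃ A ∈ Γ, PreFormula.free A

local infix:45 " ⊢ₛ " => Sequent.mk

open PreFormula Formula in
/-- `Rule ps s`: the sequent `s` is the conclusion, and `ps` is the list of premises, of an instance
of an inference rule.  Each two-way rule is given by its two directions. -/
inductive Rule : List (Sequent L) → Sequent L → Prop
  | ident (Γ : Finset (Formula L)) (A : Formula L) :
      Rule [] (insert A Γ ⊢ₛ A)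
  | trueI (Γ : Finset (Formula L)) :
      Rule [] (Γ ⊢ₛ neg falsum)
  | em (Γ : Finset (Formula L)) (A : Formula L) :
      Rule [] (Γ ⊢ₛ disj A (neg A))
  | falseE (Γ : Finset (Formula L)) (A : Formula L) :
      Rule [Γ ⊢ₛ falsum] (Γ ⊢ₛ A)
  | conjI (Γ : Finset (Formula L)) (A₁ A₂ : Formula L) :
      Rule [Γ ⊢ₛ A₁, Γ ⊢ₛ A₂] (Γ ⊢ₛ conj A₁ A₂)
  | conjE₁ (Γ : Finset (Formula L)) (A₁ A₂ : Formula L) :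
      Rule [Γ ⊢ₛ conj A₁ A₂] (Γ ⊢ₛ A₁)
  | conjE₂ (Γ : Finset (Formula L)) (A₁ A₂ : Formula L) :
      Rule [Γ ⊢ₛ conj A₁ A₂] (Γ ⊢ₛ A₂)
  | disjI₁ (Γ : Finset (Formula L)) (A₁ A₂ : Formula L) :
      Rule [Γ ⊢ₛ A₁] (Γ ⊢ₛ disj A₁ A₂)
  | disjI₂ (Γ : Finset (Formula L)) (A₁ A₂ : Formula L) :
      Rule [Γ ⊢ₛ A₂] (Γ ⊢ₛ disj A₁ A₂)
  | disjE (Γ : Finset (Formula L)) (A₁ A₂ A₃ : Formula L) :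
      Rule [Γ ⊢ₛ disj A₁ A₂, insert A₁ Γ ⊢ₛ A₃, insert A₂ Γ ⊢ₛ A₃] (Γ ⊢ₛ A₃)
  | implI (Γ : Finset (Formula L)) (A₁ A₂ : Formula L) :
      Rule [insert A₁ Γ ⊢ₛ A₂] (Γ ⊢ₛ impl A₁ A₂)
  | implE (Γ : Finset (Formula L)) (A₁ A₂ : Formula L) :
      Rule [Γ ⊢ₛ impl A₁ A₂, Γ ⊢ₛ A₁] (Γ ⊢ₛ A₂)
  | forallI (Γ : Finset (Formula L)) (x : ℕ) (A : Formula L) (hx : x ∉ freeVars Γ) :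
      Rule [Γ ⊢ₛ A] (Γ ⊢ₛ forall_ x A)
  | forallE (Γ : Finset (Formula L)) (x : ℕ) (t : L.Term ℕ) (A : Formula L) :
      Rule [Γ ⊢ₛ forall_ x A] (Γ ⊢ₛ subst x t A)
  | existsI (Γ : Finset (Formula L)) (x : ℕ) (t : L.Term ℕ) (A : Formula L) :
      Rule [Γ ⊢ₛ subst x t A] (Γ ⊢ₛ exists_ x A)
  | existsE (Γ : Finset (Formula L)) (x : ℕ) (A₁ A₂ : Formula L)
      (hx : x ∉ freeVars (Γ ∪ {A₂})) :
      Rule [Γ ⊢ₛ exists_ x A₁, insert A₁ Γ ⊢ₛ A₂] (Γ ⊢ₛ A₂)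
  | eqI (Γ : Finset (Formula L)) (t : L.Term ℕ) :
      Rule [] (Γ ⊢ₛ Formula.eq t t)
  | eqE (Γ : Finset (Formula L)) (x : ℕ) (t₁ t₂ : L.Term ℕ) (A : Formula L) :
      Rule [Γ ⊢ₛ Formula.eq t₁ t₂, Γ ⊢ₛ subst x t₁ A] (Γ ⊢ₛ subst x t₂ A)
  | negM (Γ : Finset (Formula L)) (A : Formula L) :
      Rule [Γ ⊢ₛ neg (neg A)] (Γ ⊢ₛ A)
  | negM' (Γ : Finset (Formula L)) (A : Formula L) :
      Rule [Γ ⊢ₛ A] (Γ ⊢ₛ neg (neg A))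
  | conjM (Γ : Finset (Formula L)) (A₁ A₂ : Formula L) :
      Rule [Γ ⊢ₛ neg (conj A₁ A₂)] (Γ ⊢ₛ disj (neg A₁) (neg A₂))
  | conjM' (Γ : Finset (Formula L)) (A₁ A₂ : Formula L) :
      Rule [Γ ⊢ₛ disj (neg A₁) (neg A₂)] (Γ ⊢ₛ neg (conj A₁ A₂))
  | disjM (Γ : Finset (Formula L)) (A₁ A₂ : Formula L) :
      Rule [Γ ⊢ₛ neg (disj A₁ A₂)] (Γ ⊢ₛ conj (neg A₁) (neg A₂))
  | disjM' (Γ : Finset (Formula L)) (A₁ A₂ : Formula L) :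
      Rule [Γ ⊢ₛ conj (neg A₁) (neg A₂)] (Γ ⊢ₛ neg (disj A₁ A₂))
  | implM (Γ : Finset (Formula L)) (A₁ A₂ : Formula L) :
      Rule [Γ ⊢ₛ neg (impl A₁ A₂)] (Γ ⊢ₛ conj A₁ (neg A₂))
  | implM' (Γ : Finset (Formula L)) (A₁ A₂ : Formula L) :
      Rule [Γ ⊢ₛ conj A₁ (neg A₂)] (Γ ⊢ₛ neg (impl A₁ A₂))
  | forallM (Γ : Finset (Formula L)) (x : ℕ) (A : Formula L) :
      Rule [Γ ⊢ₛ neg (forall_ x A)] (Γ ⊢ₛ exists_ x (neg A))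
  | forallM' (Γ : Finset (Formula L)) (x : ℕ) (A : Formula L) :
      Rule [Γ ⊢ₛ exists_ x (neg A)] (Γ ⊢ₛ neg (forall_ x A))
  | existsM (Γ : Finset (Formula L)) (x : ℕ) (A : Formula L) :
      Rule [Γ ⊢ₛ neg (exists_ x A)] (Γ ⊢ₛ forall_ x (neg A))
  | existsM' (Γ : Finset (Formula L)) (x : ℕ) (A : Formula L) :
      Rule [Γ ⊢ₛ forall_ x (neg A)] (Γ ⊢ₛ neg (exists_ x A))

/-- `l` is a derivation of `s` from the set of sequents `H`: its last entry is `s`, and each entry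
is in `H` or is the conclusion of a rule instance whose premises occur earlier in `l`. -/
def IsDerivation (H : Set (Sequent L)) (l : List (Sequent L)) (s : Sequent L) : Prop :=
  l.getLast? = some s ∧
    ∀ i : Fin l.length, l.get i ∈ H ∨
      ∃ ps, Rule ps (l.get i) ∧ ∀ p ∈ ps, ∃ j : Fin l.length, j < i ∧ l.get j = p

/-- A sequent is provable if it has a derivation from the empty set of sequents. -/
def Provable (Γ : Finset (Formula L)) (A : Formula L) : Prop :=
  ∃ l, IsDerivation ∅ l (Γ ⊢ₛ A)

end ProofSystem

/-! ### Interpretation -/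

/-- The truth values: true, false, both true and false. -/
inductive TruthValue
  | tt | ff | both

namespace TruthValue

open Classical in
/-- The value of a negation. -/
noncomputable def neg (a : TruthValue) : TruthValue :=
  if a = ff then tt else if a = tt then ff else both

open Classical in
/-- The value of a conjunction. -/
noncomputable def conj (a b : TruthValue) : TruthValue :=
  if a = tt ∧ b = tt then tt else if a = ff ∨ b = ff then ff else both

open Classical in
/-- The value of a disjunction. -/
noncomputable def disj (a b : TruthValue) : TruthValue :=
  if a = tt ∨ b = tt then tt else if a = ff ∧ b = ff then ff else both

open Classical in
/-- The value of an implication. -/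
noncomputable def impl (a b : TruthValue) : TruthValue :=
  if a = ff ∨ b = tt then tt else if a ≠ ff ∧ b = ff then ff else both

open Classical in
/-- The value of a universal quantification, `a d` being the value of its body at `d`. -/
noncomputable def all {U : Type w} (a : U → TruthValue) : TruthValue :=
  if ∀ d, a d = tt then tt else if ∃ d, a d = ff then ff else both

open Classical in
/-- The value of an existential quantification, `a d` being the value of its body at `d`. -/
noncomputable def ex {U : Type w} (a : U → TruthValue) : TruthValue :=
  if ∃ d, a d = tt then tt else if ∀ d, a d = ff then ff else both

end TruthValue

/-- Three-valued structures over the signature `L`.  Equality is not false exactly for identical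
arguments. -/
structure Struc (L : FirstOrder.Language.{u, v}) where
  U : Type w
  nonempty : Nonempty U
  func {n : ℕ} : L.Functions n → (Fin n → U) → U
  pred {n : ℕ} : L.Relations n → (Fin n → U) → TruthValue
  eq : U → U → TruthValue
  eq_self (d : U) : eq d d = TruthValue.tt ∨ eq d d = TruthValue.both
  eq_ne (d d' : U) : d ≠ d' → eq d d' = TruthValue.ff

section Interpretation

variable {L : FirstOrder.Language.{u, v}}

/-- The value of a term, given values for the variables. -/
def termVal (S : Struc.{u, v, w} L) {V : Type} (e : V → S.U) : L.Term V → S.U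
  | FirstOrder.Language.Term.var x => e x
  | FirstOrder.Language.Term.func f ts => S.func f fun i => termVal S e (ts i)

/-- The truth value of a formula; `α` is the assignment and `β` gives the values of the enclosing
quantified variables. -/
noncomputable def eval (S : Struc.{u, v, w} L) (α : ℕ → S.U) :
    {n : ℕ} → (Fin n → S.U) → PreFormula L n → TruthValue
  | _, _, PreFormula.falsum => TruthValue.ff
  | _, β, PreFormula.pred P ts => S.pred P fun i => termVal S (Sum.elim α β) (ts i)
  | _, β, PreFormula.equal t₁ t₂ =>
      S.eq (termVal S (Sum.elim α β) t₁) (termVal S (Sum.elim α β) t₂)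
  | _, β, PreFormula.neg A => (eval S α β A).neg
  | _, β, PreFormula.conj A₁ A₂ => (eval S α β A₁).conj (eval S α β A₂)
  | _, β, PreFormula.disj A₁ A₂ => (eval S α β A₁).disj (eval S α β A₂)
  | _, β, PreFormula.impl A₁ A₂ => (eval S α β A₁).impl (eval S α β A₂)
  | _, β, PreFormula.all A => TruthValue.all fun d => eval S α (Fin.snoc β d) A
  | _, β, PreFormula.ex A => TruthValue.ex fun d => eval S α (Fin.snoc β d) A

/-- The truth value of the formula `A` in the structure `S` under the assignment `α`. -/
noncomputable def interp (S : Struc.{u, v, w} L) (α : ℕ → S.U) (A : Formula L) : TruthValue :=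
  eval S α Fin.elim0 A

/-- `A` is a logical consequence of `Γ`. -/
def LCon (Γ : Finset (Formula L)) (A : Formula L) : Prop :=
  ∀ (S : Struc.{u, v, w} L) (α : ℕ → S.U),
    (∃ A' ∈ Γ, interp S α A' = TruthValue.ff) ∨
      interp S α A = TruthValue.tt ∨ interp S α A = TruthValue.both

/-! The next facts confirm that `forall_ x A` and `exists_ x A` are interpreted by letting the value
of the variable symbol `x` range over the domain. -/

theorem termVal_relabel (S : Struc.{u, v, w} L) {V W : Type} (g : V → W) (e : W → S.U)
    (t : L.Term V) : termVal S e (t.relabel g) = termVal S (e ∘ g) t := by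
  induction t with
  | var x => rfl
  | func f ts ih => simp [termVal, FirstOrder.Language.Term.relabel, ih]

theorem elim_comp_closeVar (S : Struc.{u, v, w} L) (α : ℕ → S.U) (x : ℕ) (d : S.U) {n : ℕ}
    (β : Fin n → S.U) :
    Sum.elim α (Fin.cons d β : Fin (n + 1) → S.U) ∘ PreFormula.closeVar x
      = Sum.elim (Function.update α x d) β := by
  funext y
  rcases y with y | i
  · by_cases h : y = x <;> simp [PreFormula.closeVar, h]
  · simp [PreFormula.closeVar]

theorem eval_close (S : Struc.{u, v, w} L) (α : ℕ → S.U) (x : ℕ) (d : S.U) {n : ℕ}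
    (A : PreFormula L n) (β : Fin n → S.U) :
    eval S α (Fin.cons d β : Fin (n + 1) → S.U) (A.close x)
      = eval S (Function.update α x d) β A := by
  induction A with
  | falsum => rfl
  | pred P ts => simp only [PreFormula.close, eval, termVal_relabel, elim_comp_closeVar]
  | equal t₁ t₂ => simp only [PreFormula.close, eval, termVal_relabel, elim_comp_closeVar]
  | neg A ih => simp only [PreFormula.close, eval, ih]
  | conj A₁ A₂ ih₁ ih₂ => simp only [PreFormula.close, eval, ih₁, ih₂]
  | disj A₁ A₂ ih₁ ih₂ => simp only [PreFormula.close, eval, ih₁, ih₂]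
  | impl A₁ A₂ ih₁ ih₂ => simp only [PreFormula.close, eval, ih₁, ih₂]
  | all A ih => simp only [PreFormula.close, eval, ← Fin.cons_snoc_eq_snoc_cons, ih]
  | ex A ih => simp only [PreFormula.close, eval, ← Fin.cons_snoc_eq_snoc_cons, ih]

theorem snoc_elim0 {U : Type w} (d : U) :
    (Fin.snoc (Fin.elim0 : Fin 0 → U) d : Fin 1 → U) = Fin.cons d (Fin.elim0 : Fin 0 → U) := by
  funext i
  fin_cases i
  rfl

theorem interp_forall (S : Struc.{u, v, w} L) (α : ℕ → S.U) (x : ℕ) (A : Formula L) :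
    interp S α (Formula.forall_ x A)
      = TruthValue.all fun d => interp S (Function.update α x d) A := by
  simp only [interp, Formula.forall_, eval, snoc_elim0, eval_close]

theorem interp_exists (S : Struc.{u, v, w} L) (α : ℕ → S.U) (x : ℕ) (A : Formula L) :
    interp S α (Formula.exists_ x A)
      = TruthValue.ex fun d => interp S (Function.update α x d) A := by
  simp only [interp, Formula.exists_, eval, snoc_elim0, eval_close]

end Interpretation

end LPif

/-!
Call a set `Δ` of formulas saturated if it is deductively closed and does not contain `⊥`, contains
a disjunct of each of its disjunctions, and contains an instance of each existential formula in it.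
By excluded middle and the two-way rules, the truth value that a saturated set assigns to a formula
(`A ∈ Δ` meaning that `A` is not false, and `¬A ∈ Δ` that it is not true) is determined by the
values assigned to atoms and equations. The terms modulo the equations in `Δ` form a structure with
these values, so the set of formulas that are not false in it is `Δ` itself.

If `Γ ⊢ A` is not provable, then a saturated `Δ ⊇ Γ` with `A ∉ Δ` exists: by the Rasiowa–Sikorski
lemma, the finite sets from which `A` is not derivable contain an ideal that decides every formula
and has a witness for every existential formula in it, and `Δ` is the union of this ideal.
-/

namespace LPif

open FirstOrder.Language (Term)

variable {L : FirstOrder.Language.{u, v}}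

section Terms

variable {V W X : Type}

theorem mem_varFinsetLeft_iff [DecidableEq V] [DecidableEq W] {x : V} {t : L.Term (V ⊕ W)} :
    x ∈ t.varFinsetLeft ↔ Sum.inl x ∈ t.varFinset := by
  induction t with
  | var z => cases z <;> simp [Term.varFinset, Term.varFinsetLeft]
  | func f ts ih => simp [Term.varFinset, Term.varFinsetLeft, ih]

theorem term_subst_congr [DecidableEq V] {f g : V → L.Term W} {t : L.Term V}
    (h : ∀ x ∈ t.varFinset, f x = g x) : t.subst f = t.subst g := by
  induction t with
  | var x => exact h x (by simp [Term.varFinset])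
  | func F ts ih =>
    simp only [Term.subst, Term.func.injEq, heq_eq_eq, true_and]
    exact funext fun i => ih i fun x hx => h x (by simpa [Term.varFinset] using ⟨i, hx⟩)

theorem term_relabel_eq_subst (g : V → W) (t : L.Term V) :
    t.relabel g = t.subst fun x => Term.var (g x) := by
  induction t with
  | var x => rfl
  | func F ts ih => simp [Term.subst, Term.relabel, ih]

theorem term_subst_subst (f : V → L.Term W) (g : W → L.Term X) (t : L.Term V) :
    (t.subst f).subst g = t.subst fun x => (f x).subst g := by
  induction t with
  | var x => rfl
  | func F ts ih => simp [Term.subst, ih]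

theorem term_subst_var (t : L.Term V) : t.subst Term.var = t := by
  induction t with
  | var x => rfl
  | func F ts ih => simp [Term.subst, ih]

theorem relabel_inl_surjective [IsEmpty W] :
    Function.Surjective (Term.relabel Sum.inl : L.Term V → L.Term (V ⊕ W)) := fun t =>
  ⟨t.relabel (Sum.elim id isEmptyElim), by
    rw [Term.relabel_relabel]
    convert t.relabel_id using 2
    ext (z | z)
    · rfl
    · exact isEmptyElim z⟩

end Terms

namespace PreFormula

/-- What the simultaneous substitution of `σ x` for each variable `x` puts in place of a
variable. -/
def instVar (σ : ℕ → L.Term ℕ) {n : ℕ} : ℕ ⊕ Fin n → L.Term (ℕ ⊕ Fin n)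
  | Sum.inl x => (σ x).relabel Sum.inl
  | Sum.inr i => Term.var (Sum.inr i)

/-- `A.inst σ` is the result of simultaneously substituting `σ x` for each free variable `x` of
`A`. -/
def inst (σ : ℕ → L.Term ℕ) : {n : ℕ} → PreFormula L n → PreFormula L n
  | _, falsum => falsum
  | _, pred P ts => pred P fun i => (ts i).subst (instVar σ)
  | _, equal t₁ t₂ => equal (t₁.subst (instVar σ)) (t₂.subst (instVar σ))
  | _, neg A => neg (inst σ A)
  | _, conj A₁ A₂ => conj (inst σ A₁) (inst σ A₂)
  | _, disj A₁ A₂ => disj (inst σ A₁) (inst σ A₂)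
  | _, impl A₁ A₂ => impl (inst σ A₁) (inst σ A₂)
  | _, all A => all (inst σ A)
  | _, ex A => ex (inst σ A)

section Substitution

variable {n : ℕ} {σ τ : ℕ → L.Term ℕ} {x y : ℕ}

theorem substVar_eq_instVar (x : ℕ) (t : L.Term ℕ) :
    (substVar x t : ℕ ⊕ Fin n → _) = instVar (Function.update Term.var x t) := by
  ext (z | i)
  · obtain rfl | hz := eq_or_ne z x <;> simp [substVar, instVar, Term.relabel, *]
  · rfl

theorem subst_eq_inst (x : ℕ) (t : L.Term ℕ) (A : PreFormula L n) :
    A.subst x t = A.inst (Function.update Term.var x t) := by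
  induction A with
  | falsum => rfl
  | pred | equal => simp only [subst, inst, substVar_eq_instVar]
  | neg _ ih | all _ ih | ex _ ih => simp only [subst, inst, ih]
  | conj _ _ ih₁ ih₂ | disj _ _ ih₁ ih₂ | impl _ _ ih₁ ih₂ => simp only [subst, inst, ih₁, ih₂]

theorem term_subst_instVar_congr {t : L.Term (ℕ ⊕ Fin n)}
    (h : ∀ z ∈ t.varFinsetLeft, σ z = τ z) : t.subst (instVar σ) = t.subst (instVar τ) := by
  refine term_subst_congr ?_
  rintro (z | i) hz
  · simp only [instVar, h z (mem_varFinsetLeft_iff.2 hz)]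
  · rfl

theorem inst_congr {A : PreFormula L n} (h : ∀ z ∈ A.free, σ z = τ z) : A.inst σ = A.inst τ := by
  induction A with
  | falsum => rfl
  | pred P ts =>
    exact congrArg _ (funext fun i => term_subst_instVar_congr fun z hz => h z ⟨i, hz⟩)
  | equal t₁ t₂ =>
    exact congrArg₂ _ (term_subst_instVar_congr fun z hz => h z (.inl hz))
      (term_subst_instVar_congr fun z hz => h z (.inr hz))
  | neg _ ih | all _ ih | ex _ ih => exact congrArg _ (ih h)
  | conj _ _ ih₁ ih₂ | disj _ _ ih₁ ih₂ | impl _ _ ih₁ ih₂ =>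
    exact congrArg₂ _ (ih₁ fun z hz => h z (.inl hz)) (ih₂ fun z hz => h z (.inr hz))

theorem inst_update_of_notMem_free {A : PreFormula L n} (h : x ∉ A.free) (t : L.Term ℕ) :
    A.inst (Function.update σ x t) = A.inst σ :=
  inst_congr fun _ hz => Function.update_of_ne (ne_of_mem_of_not_mem hz h) ..

theorem term_subst_instVar_instVar (t : L.Term (ℕ ⊕ Fin n)) :
    (t.subst (instVar σ)).subst (instVar τ) = t.subst (instVar fun z => (σ z).subst τ) := by
  rw [term_subst_subst]
  congr 1
  ext (z | i)
  · simp only [instVar, term_relabel_eq_subst, term_subst_subst, Term.subst]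
  · rfl

theorem inst_inst (A : PreFormula L n) : (A.inst σ).inst τ = A.inst fun z => (σ z).subst τ := by
  induction A with
  | falsum => rfl
  | pred | equal => simp only [inst, term_subst_instVar_instVar]
  | neg _ ih | all _ ih | ex _ ih => simp only [inst, ih]
  | conj _ _ ih₁ ih₂ | disj _ _ ih₁ ih₂ | impl _ _ ih₁ ih₂ => simp only [inst, ih₁, ih₂]

theorem instVar_var : (instVar Term.var : ℕ ⊕ Fin n → L.Term _) = Term.var := by
  ext (z | i) <;> rfl

theorem inst_var (A : PreFormula L n) : A.inst Term.var = A := by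
  induction A with
  | falsum => rfl
  | pred | equal => simp only [inst, instVar_var, term_subst_var]
  | neg _ ih | all _ ih | ex _ ih => simp only [inst, ih]
  | conj _ _ ih₁ ih₂ | disj _ _ ih₁ ih₂ | impl _ _ ih₁ ih₂ => simp only [inst, ih₁, ih₂]

theorem subst_var_self (x : ℕ) (A : PreFormula L n) : A.subst x (Term.var x) = A := by
  rw [subst_eq_inst, Function.update_eq_self, inst_var]

theorem subst_of_notMem_free {A : PreFormula L n} (h : x ∉ A.free) (t : L.Term ℕ) :
    A.subst x t = A := by
  rw [subst_eq_inst, inst_update_of_notMem_free h, inst_var]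

theorem term_close_inst {t : L.Term (ℕ ⊕ Fin n)}
    (h : ∀ z ∈ t.varFinsetLeft, z ≠ x → y ∉ (σ z).varFinset) :
    (t.relabel (closeVar x)).subst (instVar σ) =
      (t.subst (instVar (Function.update σ x (Term.var y)))).relabel (closeVar y) := by
  simp only [term_relabel_eq_subst (closeVar _), term_subst_subst, Term.subst]
  refine term_subst_congr ?_
  rintro (z | i) hz
  · obtain rfl | hzx := eq_or_ne z x
    · simp [closeVar, instVar, Term.subst, Term.relabel]
    · have hy := h z (mem_varFinsetLeft_iff.2 hz) hzx
      simp only [closeVar, if_neg hzx, instVar, Function.update_of_ne hzx, term_relabel_eq_subst,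
        term_subst_subst, Term.subst]
      exact term_subst_congr fun w hw => by rw [if_neg (ne_of_mem_of_not_mem hw hy)]
  · rfl

theorem close_inst {A : PreFormula L n} (h : ∀ z ∈ A.free, z ≠ x → y ∉ (σ z).varFinset) :
    (A.close x).inst σ = (A.inst (Function.update σ x (Term.var y))).close y := by
  induction A with
  | falsum => rfl
  | pred P ts => exact congrArg _ (funext fun i => term_close_inst fun z hz => h z ⟨i, hz⟩)
  | equal t₁ t₂ =>
    exact congrArg₂ _ (term_close_inst fun z hz => h z (.inl hz))
      (term_close_inst fun z hz => h z (.inr hz))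
  | neg _ ih | all _ ih | ex _ ih => exact congrArg _ (ih h)
  | conj _ _ ih₁ ih₂ | disj _ _ ih₁ ih₂ | impl _ _ ih₁ ih₂ =>
    exact congrArg₂ _ (ih₁ fun z hz => h z (.inl hz)) (ih₂ fun z hz => h z (.inr hz))

theorem inst_update_subst {A : PreFormula L n} (h : ∀ z ∈ A.free, z ≠ x → y ∉ (σ z).varFinset)
    (t : L.Term ℕ) :
    (A.inst (Function.update σ x (Term.var y))).subst y t = A.inst (Function.update σ x t) := by
  rw [subst_eq_inst, inst_inst]
  refine inst_congr fun z hz => ?_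
  obtain rfl | hzx := eq_or_ne z x
  · simp [Term.subst]
  · simp only [Function.update_of_ne hzx]
    conv_rhs => rw [← term_subst_var (σ z)]
    exact term_subst_congr fun w hw =>
      Function.update_of_ne (ne_of_mem_of_not_mem hw (h z hz hzx)) ..

theorem subst_inst (x : ℕ) (t : L.Term ℕ) (A : PreFormula L n) :
    (A.subst x t).inst σ = A.inst (Function.update σ x (t.subst σ)) := by
  rw [subst_eq_inst, inst_inst]
  refine inst_congr fun z _ => ?_
  obtain rfl | hzx := eq_or_ne z x <;> simp [Term.subst, *]

theorem close_subst_var {A : PreFormula L n} (h : y ∉ A.free) :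
    (A.subst x (Term.var y)).close y = A.close x := by
  rw [subst_eq_inst, ← close_inst, inst_var]
  rintro z hz -
  simpa [Term.varFinset] using fun hyz : y = z => h (hyz ▸ hz)

end Substitution

section FreeVariables

variable {n : ℕ}

theorem finite_free (A : PreFormula L n) : A.free.Finite := by
  induction A with
  | falsum => exact Set.finite_empty
  | pred P ts =>
    simp only [free, Set.ofPred_exists]
    exact Set.finite_iUnion fun i => (ts i).varFinsetLeft.finite_toSet
  | equal t₁ t₂ => exact t₁.varFinsetLeft.finite_toSet.union t₂.varFinsetLeft.finite_toSet
  | neg _ ih | all _ ih | ex _ ih => exact ih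
  | conj _ _ ih₁ ih₂ | disj _ _ ih₁ ih₂ | impl _ _ ih₁ ih₂ => exact ih₁.union ih₂

theorem notMem_varFinsetLeft_closeVar (x : ℕ) (t : L.Term (ℕ ⊕ Fin n)) :
    x ∉ (t.relabel (closeVar x)).varFinsetLeft := by
  induction t with
  | var z =>
    rcases z with z | i
    · obtain rfl | hz := eq_or_ne z x <;>
        simp [Term.relabel, closeVar, Term.varFinsetLeft, Ne.symm, *]
    · simp [Term.relabel, closeVar, Term.varFinsetLeft]
  | func F ts ih => simpa [Term.relabel, Term.varFinsetLeft] using ih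

theorem notMem_free_close (x : ℕ) (A : PreFormula L n) : x ∉ (A.close x).free := by
  induction A with
  | falsum => exact Set.notMem_empty _
  | pred P ts => exact fun ⟨i, hi⟩ => notMem_varFinsetLeft_closeVar x (ts i) hi
  | equal t₁ t₂ =>
    exact fun h => h.elim (notMem_varFinsetLeft_closeVar x t₁) (notMem_varFinsetLeft_closeVar x t₂)
  | neg _ ih | all _ ih | ex _ ih => exact ih
  | conj _ _ ih₁ ih₂ | disj _ _ ih₁ ih₂ | impl _ _ ih₁ ih₂ => exact fun h => h.elim ih₁ ih₂

end FreeVariables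

end PreFormula

theorem finite_freeVars (Γ : Finset (Formula L)) : (freeVars Γ).Finite :=
  Γ.finite_toSet.biUnion fun A _ => A.finite_free

/-! ### Induction on formulas -/

namespace PreFormula

theorem exists_relabel_closeVar_eq {x n : ℕ} {t : L.Term (ℕ ⊕ Fin (n + 1))}
    (h : x ∉ t.varFinsetLeft) : ∃ s : L.Term (ℕ ⊕ Fin n), s.relabel (closeVar x) = t := by
  refine ⟨t.relabel (Sum.elim Sum.inl (Fin.cases (Sum.inl x) Sum.inr)), ?_⟩
  conv_rhs => rw [← term_subst_var t]
  rw [term_relabel_eq_subst, term_relabel_eq_subst, term_subst_subst]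
  refine term_subst_congr ?_
  rintro (z | i) hz
  · have hzx : z ≠ x := ne_of_mem_of_not_mem (mem_varFinsetLeft_iff.2 hz) h
    simp [Term.subst, closeVar, hzx]
  · cases i using Fin.cases <;> simp [Term.subst, closeVar]

theorem exists_close_eq_of_notMem_free {x : ℕ} :
    ∀ {n : ℕ} (B : PreFormula L (n + 1)), x ∉ B.free → ∃ A : PreFormula L n, A.close x = B
  | _, .falsum, _ => ⟨falsum, rfl⟩
  | _, .pred P _, h => by
    choose s hs using fun i => exists_relabel_closeVar_eq fun hi => h ⟨i, hi⟩
    exact ⟨pred P s, congrArg (pred P) (funext hs)⟩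
  | _, .equal _ _, h => by
    obtain ⟨s₁, rfl⟩ := exists_relabel_closeVar_eq fun h₁ => h (.inl h₁)
    obtain ⟨s₂, rfl⟩ := exists_relabel_closeVar_eq fun h₂ => h (.inr h₂)
    exact ⟨equal s₁ s₂, rfl⟩
  | _, .neg B, h => (exists_close_eq_of_notMem_free B h).elim fun A hA => ⟨neg A, congrArg neg hA⟩
  | _, .all B, h => (exists_close_eq_of_notMem_free B h).elim fun A hA => ⟨all A, congrArg all hA⟩
  | _, .ex B, h => (exists_close_eq_of_notMem_free B h).elim fun A hA => ⟨ex A, congrArg ex hA⟩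
  | _, .conj B₁ B₂, h => by
    obtain ⟨A₁, rfl⟩ := exists_close_eq_of_notMem_free B₁ fun h₁ => h (.inl h₁)
    obtain ⟨A₂, rfl⟩ := exists_close_eq_of_notMem_free B₂ fun h₂ => h (.inr h₂)
    exact ⟨conj A₁ A₂, rfl⟩
  | _, .disj B₁ B₂, h => by
    obtain ⟨A₁, rfl⟩ := exists_close_eq_of_notMem_free B₁ fun h₁ => h (.inl h₁)
    obtain ⟨A₂, rfl⟩ := exists_close_eq_of_notMem_free B₂ fun h₂ => h (.inr h₂)
    exact ⟨disj A₁ A₂, rfl⟩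
  | _, .impl B₁ B₂, h => by
    obtain ⟨A₁, rfl⟩ := exists_close_eq_of_notMem_free B₁ fun h₁ => h (.inl h₁)
    obtain ⟨A₂, rfl⟩ := exists_close_eq_of_notMem_free B₂ fun h₂ => h (.inr h₂)
    exact ⟨impl A₁ A₂, rfl⟩

theorem exists_close_eq {n : ℕ} (B : PreFormula L (n + 1)) :
    ∃ x, ∃ A : PreFormula L n, A.close x = B :=
  B.finite_free.exists_notMem.imp fun _ => exists_close_eq_of_notMem_free B

/-- The number of constructors of a formula, a measure invariant under substitution and
binding. -/
def size : {n : ℕ} → PreFormula L n → ℕ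
  | _, falsum => 1
  | _, pred _ _ => 1
  | _, equal _ _ => 1
  | _, neg A => size A + 1
  | _, conj A₁ A₂ => size A₁ + size A₂ + 1
  | _, disj A₁ A₂ => size A₁ + size A₂ + 1
  | _, impl A₁ A₂ => size A₁ + size A₂ + 1
  | _, all A => size A + 1
  | _, ex A => size A + 1

theorem size_close (x : ℕ) {n : ℕ} (A : PreFormula L n) : (A.close x).size = A.size := by
  induction A <;> simp_all only [close, size]

theorem size_subst (x : ℕ) (t : L.Term ℕ) {n : ℕ} (A : PreFormula L n) :
    (A.subst x t).size = A.size := by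
  induction A <;> simp_all only [subst, size]

end PreFormula

namespace Formula

open PreFormula

/-- The formula `P (t₁, …, tₙ)`. -/
def atom {k : ℕ} (P : L.Relations k) (ts : Fin k → L.Term ℕ) : Formula L :=
  pred P fun i => (ts i).relabel Sum.inl

theorem induction {p : Formula L → Prop} (falsum : p falsum)
    (atom : ∀ {k : ℕ} (P : L.Relations k) (ts : Fin k → L.Term ℕ), p (atom P ts))
    (eq : ∀ t₁ t₂, p (eq t₁ t₂)) (neg : ∀ A, p A → p (neg A))
    (conj : ∀ A₁ A₂, p A₁ → p A₂ → p (conj A₁ A₂))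
    (disj : ∀ A₁ A₂, p A₁ → p A₂ → p (disj A₁ A₂))
    (impl : ∀ A₁ A₂, p A₁ → p A₂ → p (impl A₁ A₂))
    (forall_ : ∀ x A, (∀ t, p (A.subst x t)) → p (forall_ x A))
    (exists_ : ∀ x A, (∀ t, p (A.subst x t)) → p (exists_ x A)) (A : Formula L) : p A := by
  induction hA : A.size using Nat.strong_induction_on generalizing A with
  | _ k ih =>
    replace ih : ∀ B : Formula L, B.size < A.size → p B := fun B hB => ih _ (hA ▸ hB) B rfl
    cases A with
    | falsum => exact falsum
    | pred P ts =>
      choose s hs using fun i => relabel_inl_surjective (ts i)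
      simpa only [Formula.atom, hs] using atom P s
    | equal t₁ t₂ =>
      obtain ⟨⟨s₁, rfl⟩, ⟨s₂, rfl⟩⟩ := relabel_inl_surjective t₁, relabel_inl_surjective t₂
      exact eq s₁ s₂
    | neg A => exact neg A (ih A (by grind [size]))
    | conj A₁ A₂ => exact conj A₁ A₂ (ih A₁ (by grind [size])) (ih A₂ (by grind [size]))
    | disj A₁ A₂ => exact disj A₁ A₂ (ih A₁ (by grind [size])) (ih A₂ (by grind [size]))
    | impl A₁ A₂ => exact impl A₁ A₂ (ih A₁ (by grind [size])) (ih A₂ (by grind [size]))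
    | all B =>
      obtain ⟨x, A, rfl⟩ := exists_close_eq B
      exact forall_ x A fun t => ih _ (by grind [size, size_close, size_subst])
    | ex B =>
      obtain ⟨x, A, rfl⟩ := exists_close_eq B
      exact exists_ x A fun t => ih _ (by grind [size, size_close, size_subst])

end Formula

namespace PreFormula

variable [∀ n, Countable (L.Functions n)] [∀ n, Countable (L.Relations n)]

theorem countable_setOf_size_lt (k n : ℕ) : {A : PreFormula L n | A.size < k}.Countable := by
  induction k generalizing n with
  | zero => simp
  | succ k ih =>
    have atomic : (Set.range fun a : Σ m, L.Relations m × (Fin m → L.Term (ℕ ⊕ Fin n)) =>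
        pred a.2.1 a.2.2).Countable := Set.countable_range _
    have equation : (Set.range fun a : L.Term (ℕ ⊕ Fin n) × L.Term (ℕ ⊕ Fin n) =>
        equal a.1 a.2).Countable := Set.countable_range _
    refine (((((((((Set.countable_singleton falsum).union atomic).union equation).union
      ((ih n).image neg)).union ((ih n).image2 (ih n) conj)).union
      ((ih n).image2 (ih n) disj)).union ((ih n).image2 (ih n) impl)).union
      ((ih (n + 1)).image all)).union ((ih (n + 1)).image ex)).mono fun A hA => ?_
    cases A <;>
      simp only [Set.mem_union, Set.mem_singleton_iff, Set.mem_range, Set.mem_image,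
        Set.mem_image2, Set.mem_ofPred_eq, Sigma.exists, Prod.exists, size] at hA ⊢ <;> grind

instance countable (n : ℕ) : Countable (PreFormula L n) := by
  rw [← Set.countable_univ_iff]
  refine (Set.countable_iUnion fun k => countable_setOf_size_lt k n).mono fun A _ => ?_
  exact Set.mem_iUnion.2 ⟨A.size + 1, Nat.lt_succ_self A.size⟩

end PreFormula

open PreFormula Formula

local infix:45 " ⊢ₛ " => Sequent.mk

section Derivability

variable {s p q r : Sequent L} {l l₁ l₂ ps : List (Sequent L)} {Γ : Finset (Formula L)}
  {A : Formula L}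

/-- Provability as an inductive predicate on sequents, for proofs by induction on derivations; see
`provable_iff_derivable`. -/
inductive Derivable : Sequent L → Prop
  | rule {ps : List (Sequent L)} {s : Sequent L} (hr : Rule ps s) (hp : ∀ p ∈ ps, Derivable p) :
    Derivable s

/-- The sequences of sequents each of which is inferred from earlier ones, generated from left to
right. -/
inductive IsProof : List (Sequent L) → Prop
  | nil : IsProof []
  | concat {l ps : List (Sequent L)} {s : Sequent L} (hl : IsProof l) (hr : Rule ps s)
    (hp : ∀ p ∈ ps, p ∈ l) : IsProof (l ++ [s])

theorem IsProof.append (h₁ : IsProof l₁) (h₂ : IsProof l₂) : IsProof (l₁ ++ l₂) := by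
  induction h₂ with
  | nil => simpa only [List.append_nil] using h₁
  | concat _ hr hp ih =>
    rw [← List.append_assoc]
    exact ih.concat hr fun p h => List.mem_append_right _ (hp p h)

theorem IsProof.exists_forall_mem (h : ∀ p ∈ ps, ∃ l, IsProof (l ++ [p])) :
    ∃ l, IsProof l ∧ ∀ p ∈ ps, p ∈ l := by
  induction ps with
  | nil => exact ⟨[], .nil, by simp⟩
  | cons p ps ih =>
    rw [List.forall_mem_cons] at h
    obtain ⟨⟨l₁, h₁⟩, l₂, h₂, hps⟩ := h.imp_right ih
    exact ⟨_, h₁.append h₂, by simpa using fun q hq => .inr (.inr (hps q hq))⟩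

theorem IsProof.exists_rule (h : IsProof l) (i : Fin l.length) :
    ∃ ps, Rule ps (l.get i) ∧ ∀ p ∈ ps, ∃ j : Fin l.length, j < i ∧ l.get j = p := by
  induction h with
  | nil => exact i.elim0
  | @concat l ps s _ hr hp ih =>
    obtain ⟨i, hi⟩ := i
    obtain hil | rfl := (Nat.lt_succ_iff_lt_or_eq (n := l.length)).1 (by simpa using hi)
    · obtain ⟨ps, hr, hp⟩ := ih ⟨i, hil⟩
      refine ⟨ps, by simpa [hil] using hr, fun p h => ?_⟩
      obtain ⟨j, hji, rfl⟩ := hp p h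
      exact ⟨⟨j, by grind⟩, hji, by simp⟩
    · refine ⟨ps, by simpa using hr, fun p h => ?_⟩
      obtain ⟨j, hj, rfl⟩ := List.getElem_of_mem (hp p h)
      exact ⟨⟨j, by grind⟩, hj, by simp [hj]⟩

theorem Derivable.exists_isProof (h : Derivable s) : ∃ l, IsProof (l ++ [s]) := by
  induction h with
  | rule hr _ ih =>
    obtain ⟨l, hl, hp⟩ := IsProof.exists_forall_mem ih
    exact ⟨l, hl.concat hr hp⟩

theorem IsDerivation.derivable (h : IsDerivation ∅ l s) : Derivable s := by
  have entry (i : Fin l.length) : Derivable (l.get i) := by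
    induction i using WellFoundedLT.induction with
    | _ i ih =>
      obtain ⟨ps, hr, hp⟩ := (h.2 i).resolve_left (Set.notMem_empty _)
      refine .rule hr fun p hps => ?_
      obtain ⟨j, hji, rfl⟩ := hp p hps
      exact ih j hji
  obtain ⟨i, hi, rfl⟩ := List.getElem_of_mem (List.mem_of_getLast? h.1)
  exact entry ⟨i, hi⟩

theorem provable_iff_derivable : Provable Γ A ↔ Derivable (Γ ⊢ₛ A) := by
  refine ⟨fun ⟨l, hl⟩ => hl.derivable, fun h => ?_⟩
  obtain ⟨l, hl⟩ := h.exists_isProof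
  exact ⟨_, List.getLast?_concat, fun i => .inr (hl.exists_rule i)⟩

namespace Derivable

theorem nullary (hr : Rule [] s) : Derivable s := .rule hr (by simp)

theorem unary (hr : Rule [p] s) (hp : Derivable p) : Derivable s := .rule hr (by simp [hp])

theorem binary (hr : Rule [p, q] s) (hp : Derivable p) (hq : Derivable q) : Derivable s :=
  .rule hr (by simp [hp, hq])

theorem ternary (hr : Rule [p, q, r] s) (hp : Derivable p) (hq : Derivable q)
    (h : Derivable r) : Derivable s :=
  .rule hr (by simp [hp, hq, h])

theorem of_mem (h : A ∈ Γ) : Derivable (Γ ⊢ₛ A) := by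
  rw [← Finset.insert_eq_of_mem h]
  exact nullary (.ident Γ A)

end Derivable

/-- The pairs `(B, B')` of the two-way rules. -/
inductive DeMorgan : Formula L → Formula L → Prop
  | neg (A : Formula L) : DeMorgan (neg (neg A)) A
  | conj (A₁ A₂ : Formula L) : DeMorgan (neg (conj A₁ A₂)) (disj (neg A₁) (neg A₂))
  | disj (A₁ A₂ : Formula L) : DeMorgan (neg (disj A₁ A₂)) (conj (neg A₁) (neg A₂))
  | impl (A₁ A₂ : Formula L) : DeMorgan (neg (impl A₁ A₂)) (conj A₁ (neg A₂))
  | forall_ (x : ℕ) (A : Formula L) : DeMorgan (neg (forall_ x A)) (exists_ x (neg A))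
  | exists_ (x : ℕ) (A : Formula L) : DeMorgan (neg (exists_ x A)) (forall_ x (neg A))

theorem DeMorgan.derivable_iff {B B' : Formula L} (h : DeMorgan B B') :
    Derivable (Γ ⊢ₛ B) ↔ Derivable (Γ ⊢ₛ B') := by
  cases h with
  | neg => exact ⟨.unary (.negM ..), .unary (.negM' ..)⟩
  | conj => exact ⟨.unary (.conjM ..), .unary (.conjM' ..)⟩
  | disj => exact ⟨.unary (.disjM ..), .unary (.disjM' ..)⟩
  | impl => exact ⟨.unary (.implM ..), .unary (.implM' ..)⟩
  | forall_ => exact ⟨.unary (.forallM ..), .unary (.forallM' ..)⟩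
  | exists_ => exact ⟨.unary (.existsM ..), .unary (.existsM' ..)⟩

end Derivability

/-! ### Derivability under substitution -/

section Instantiation

variable {Γ Δ : Finset (Formula L)} {A B A₁ A₂ : Formula L} {σ : ℕ → L.Term ℕ} {x : ℕ}
  {t t₁ t₂ : L.Term ℕ} {s : Sequent L}

theorem eq_inst (t₁ t₂ : L.Term ℕ) :
    (Formula.eq t₁ t₂).inst σ = Formula.eq (t₁.subst σ) (t₂.subst σ) := by
  simp only [Formula.eq, inst, term_relabel_eq_subst, term_subst_subst, Term.subst, instVar]

theorem exists_fresh (σ : ℕ → L.Term ℕ) (Γ : Finset (Formula L)) (x : ℕ) (A : Formula L) :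
    ∃ y ∉ freeVars Γ, ∀ z ∈ A.free, z ≠ x → y ∉ (σ z).varFinset := by
  have hfin : (freeVars Γ ∪ ⋃ z ∈ A.free, ((σ z).varFinset : Set ℕ)).Finite :=
    (finite_freeVars Γ).union (A.finite_free.biUnion fun z _ => (σ z).varFinset.finite_toSet)
  obtain ⟨y, hy⟩ := hfin.exists_notMem
  exact ⟨y, fun h => hy (.inl h), fun z hz _ h => hy (.inr (Set.mem_biUnion hz h))⟩

theorem forall_inst {y : ℕ} (h : ∀ z ∈ A.free, z ≠ x → y ∉ (σ z).varFinset) :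
    (forall_ x A).inst σ = forall_ y (A.inst (Function.update σ x (Term.var y))) :=
  congrArg all (close_inst h)

theorem exists_inst {y : ℕ} (h : ∀ z ∈ A.free, z ≠ x → y ∉ (σ z).varFinset) :
    (exists_ x A).inst σ = exists_ y (A.inst (Function.update σ x (Term.var y))) :=
  congrArg ex (close_inst h)

theorem subst_inst_eq {y : ℕ} (h : ∀ z ∈ A.free, z ≠ x → y ∉ (σ z).varFinset) (t : L.Term ℕ) :
    (A.subst x t).inst σ =
      (A.inst (Function.update σ x (Term.var y))).subst y (t.subst σ) := by
  rw [subst_inst, inst_update_subst h]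

theorem DeMorgan.inst {B B' : Formula L} (h : DeMorgan B B') (σ : ℕ → L.Term ℕ) :
    DeMorgan (B.inst σ) (B'.inst σ) := by
  cases h with
  | neg A => exact .neg _
  | conj A₁ A₂ => exact .conj ..
  | disj A₁ A₂ => exact .disj ..
  | impl A₁ A₂ => exact .impl ..
  | forall_ x A =>
    obtain ⟨y, -, hy⟩ := exists_fresh σ ∅ x A
    rw [PreFormula.inst, forall_inst hy, exists_inst (A := .neg A) hy]
    exact .forall_ ..
  | exists_ x A =>
    obtain ⟨y, -, hy⟩ := exists_fresh σ ∅ x A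
    rw [PreFormula.inst, exists_inst hy, forall_inst (A := .neg A) hy]
    exact .exists_ ..

/-- All substitution instances of `s` are derivable, also with additional assumptions. Renaming
the eigenvariables takes care of the side conditions, so that the rules preserve this property. -/
def StablyDerivable (s : Sequent L) : Prop :=
  ∀ (σ : ℕ → L.Term ℕ) (Δ : Finset (Formula L)), (∀ B ∈ s.left, B.inst σ ∈ Δ) →
    Derivable (Δ ⊢ₛ s.right.inst σ)

namespace StablyDerivable

theorem inst_update (h : StablyDerivable (Γ ⊢ₛ A)) (hx : x ∉ freeVars Γ)
    (hΔ : ∀ B ∈ Γ, B.inst σ ∈ Δ) (t : L.Term ℕ) :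
    Derivable (Δ ⊢ₛ A.inst (Function.update σ x t)) := by
  refine h _ _ fun B hB => ?_
  rw [inst_update_of_notMem_free fun hxB => hx (Set.mem_biUnion hB hxB)]
  exact hΔ B hB

theorem inst_insert (h : StablyDerivable (insert B Γ ⊢ₛ A)) (hΔ : ∀ C ∈ Γ, C.inst σ ∈ Δ) :
    Derivable (insert (B.inst σ) Δ ⊢ₛ A.inst σ) :=
  h σ _ <| Finset.forall_mem_insert _ _ _ |>.2
    ⟨Finset.mem_insert_self .., fun C hC => Finset.mem_insert_of_mem (hΔ C hC)⟩

theorem forallI (hx : x ∉ freeVars Γ) (h : StablyDerivable (Γ ⊢ₛ A)) :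
    StablyDerivable (Γ ⊢ₛ forall_ x A) := fun σ Δ hΔ => by
  obtain ⟨y, hyΔ, hy⟩ := exists_fresh σ Δ x A
  rw [forall_inst hy]
  exact .unary (.forallI _ y _ hyΔ) (h.inst_update hx hΔ _)

theorem forallE (h : StablyDerivable (Γ ⊢ₛ forall_ x A)) :
    StablyDerivable (Γ ⊢ₛ A.subst x t) := fun σ Δ hΔ => by
  obtain ⟨y, -, hy⟩ := exists_fresh σ ∅ x A
  rw [subst_inst_eq hy]
  exact .unary (.forallE ..) (forall_inst hy ▸ h σ Δ hΔ)

theorem existsI (h : StablyDerivable (Γ ⊢ₛ A.subst x t)) :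
    StablyDerivable (Γ ⊢ₛ exists_ x A) := fun σ Δ hΔ => by
  obtain ⟨y, -, hy⟩ := exists_fresh σ ∅ x A
  rw [exists_inst hy]
  exact .unary (.existsI ..) (subst_inst_eq hy t ▸ h σ Δ hΔ)

theorem existsE (hx : x ∉ freeVars (Γ ∪ {A₂})) (h₁ : StablyDerivable (Γ ⊢ₛ exists_ x A₁))
    (h₂ : StablyDerivable (insert A₁ Γ ⊢ₛ A₂)) : StablyDerivable (Γ ⊢ₛ A₂) := fun σ Δ hΔ => by
  obtain ⟨y, hyΔ, hy⟩ := exists_fresh σ (Δ ∪ {A₂.inst σ}) x A₁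
  have hxB : ∀ B ∈ Γ ∪ {A₂}, x ∉ B.free := fun B hB hxB => hx (Set.mem_biUnion hB hxB)
  have hA₂ : A₂.inst (Function.update σ x (Term.var y)) = A₂.inst σ :=
    inst_update_of_notMem_free (hxB A₂ (by simp)) _
  refine .binary (.existsE _ y _ _ hyΔ) (exists_inst hy ▸ h₁ σ Δ hΔ) ?_
  rw [← hA₂]
  refine h₂.inst_insert fun B hB => ?_
  rw [inst_update_of_notMem_free (hxB B (Finset.mem_union_left _ hB))]
  exact hΔ B hB

theorem eqE (h₁ : StablyDerivable (Γ ⊢ₛ Formula.eq t₁ t₂))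
    (h₂ : StablyDerivable (Γ ⊢ₛ A.subst x t₁)) :
    StablyDerivable (Γ ⊢ₛ A.subst x t₂) := fun σ Δ hΔ => by
  obtain ⟨y, -, hy⟩ := exists_fresh σ ∅ x A
  rw [subst_inst_eq hy]
  exact .binary (.eqE ..) (eq_inst t₁ t₂ ▸ h₁ σ Δ hΔ) (subst_inst_eq hy t₁ ▸ h₂ σ Δ hΔ)

theorem deMorgan (hB : DeMorgan B A) : StablyDerivable (Γ ⊢ₛ B) ↔ StablyDerivable (Γ ⊢ₛ A) :=
  forall₃_congr fun σ _ _ => (hB.inst σ).derivable_iff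

theorem rule {ps : List (Sequent L)} (hr : Rule ps s) (hp : ∀ p ∈ ps, StablyDerivable p) :
    StablyDerivable s := by
  cases hr <;> simp only [List.mem_cons, List.not_mem_nil, forall_eq_or_imp, IsEmpty.forall_iff,
    implies_true, and_true] at hp
  case ident => exact fun σ Δ hΔ => .of_mem (hΔ _ (Finset.mem_insert_self ..))
  case trueI => exact fun σ Δ _ => .nullary (.trueI Δ)
  case em A => exact fun σ Δ _ => .nullary (.em Δ _)
  case falseE => exact fun σ Δ hΔ => .unary (.falseE ..) (hp σ Δ hΔ)
  case conjI => exact fun σ Δ hΔ => .binary (.conjI ..) (hp.1 σ Δ hΔ) (hp.2 σ Δ hΔ)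
  case conjE₁ => exact fun σ Δ hΔ => .unary (.conjE₁ ..) (hp σ Δ hΔ)
  case conjE₂ => exact fun σ Δ hΔ => .unary (.conjE₂ ..) (hp σ Δ hΔ)
  case disjI₁ => exact fun σ Δ hΔ => .unary (.disjI₁ ..) (hp σ Δ hΔ)
  case disjI₂ => exact fun σ Δ hΔ => .unary (.disjI₂ ..) (hp σ Δ hΔ)
  case disjE =>
    exact fun σ Δ hΔ => .ternary (.disjE ..) (hp.1 σ Δ hΔ) (hp.2.1.inst_insert hΔ)
      (hp.2.2.inst_insert hΔ)
  case implI => exact fun σ Δ hΔ => .unary (.implI ..) (hp.inst_insert hΔ)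
  case implE => exact fun σ Δ hΔ => .binary (.implE ..) (hp.1 σ Δ hΔ) (hp.2 σ Δ hΔ)
  case forallI hx => exact hp.forallI hx
  case forallE => exact hp.forallE
  case existsI => exact hp.existsI
  case existsE hx => exact hp.1.existsE hx hp.2
  case eqI => exact fun σ Δ _ => eq_inst (σ := σ) .. ▸ .nullary (.eqI Δ _)
  case eqE => exact hp.1.eqE hp.2
  case negM => exact (deMorgan (.neg _)).1 hp
  case negM' => exact (deMorgan (.neg _)).2 hp
  case conjM => exact (deMorgan (.conj ..)).1 hp
  case conjM' => exact (deMorgan (.conj ..)).2 hp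
  case disjM => exact (deMorgan (.disj ..)).1 hp
  case disjM' => exact (deMorgan (.disj ..)).2 hp
  case implM => exact (deMorgan (.impl ..)).1 hp
  case implM' => exact (deMorgan (.impl ..)).2 hp
  case forallM => exact (deMorgan (.forall_ ..)).1 hp
  case forallM' => exact (deMorgan (.forall_ ..)).2 hp
  case existsM => exact (deMorgan (.exists_ ..)).1 hp
  case existsM' => exact (deMorgan (.exists_ ..)).2 hp

end StablyDerivable

namespace Derivable

theorem stablyDerivable (h : Derivable s) : StablyDerivable s := by
  induction h with
  | rule hr _ ih => exact .rule hr ih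

theorem weaken (h : Derivable (Γ ⊢ₛ A)) (hΔ : Γ ⊆ Δ) : Derivable (Δ ⊢ₛ A) := by
  simpa only [inst_var] using h.stablyDerivable Term.var Δ fun B hB => (inst_var B).symm ▸ hΔ hB

theorem cut (h₁ : Derivable (Γ ⊢ₛ A)) (h₂ : Derivable (insert A Γ ⊢ₛ B)) : Derivable (Γ ⊢ₛ B) :=
  .binary (.implE Γ A B) (.unary (.implI ..) h₂) h₁

end Derivable

end Instantiation

/-! ### Soundness -/

namespace TruthValue

variable {a b : TruthValue} {U : Type w} {f : U → TruthValue}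

theorem ne_ff_iff : a ≠ ff ↔ a = tt ∨ a = both := by cases a <;> simp

theorem neg_eq_ff : a.neg = ff ↔ a = tt := by cases a <;> simp [neg]

theorem neg_eq_tt : a.neg = tt ↔ a = ff := by cases a <;> simp [neg]

theorem conj_eq_ff : a.conj b = ff ↔ a = ff ∨ b = ff := by cases a <;> cases b <;> simp [conj]

theorem conj_eq_tt : a.conj b = tt ↔ a = tt ∧ b = tt := by cases a <;> cases b <;> simp [conj]

theorem disj_eq_ff : a.disj b = ff ↔ a = ff ∧ b = ff := by cases a <;> cases b <;> simp [disj]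

theorem disj_eq_tt : a.disj b = tt ↔ a = tt ∨ b = tt := by cases a <;> cases b <;> simp [disj]

theorem impl_eq_ff : a.impl b = ff ↔ a ≠ ff ∧ b = ff := by cases a <;> cases b <;> simp [impl]

theorem impl_eq_tt : a.impl b = tt ↔ a = ff ∨ b = tt := by cases a <;> cases b <;> simp [impl]

theorem all_eq_tt : all f = tt ↔ ∀ d, f d = tt := by
  unfold all
  split_ifs <;> grind

theorem all_eq_ff : all f = ff ↔ ∃ d, f d = ff := by
  unfold all
  split_ifs <;> grind

theorem ex_eq_tt : ex f = tt ↔ ∃ d, f d = tt := by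
  unfold ex
  split_ifs <;> grind

theorem ex_eq_ff [Nonempty U] : ex f = ff ↔ ∀ d, f d = ff := by
  have := ‹Nonempty U›.some
  unfold ex
  split_ifs <;> grind

end TruthValue

section Semantics

variable {S : Struc.{u, v, w} L} {α : ℕ → S.U} {x : ℕ} {A A₁ A₂ B B' : Formula L}
  {t t₁ t₂ : L.Term ℕ}

theorem termVal_subst {V W : Type} (e : W → S.U) (f : V → L.Term W) (t : L.Term V) :
    termVal S e (t.subst f) = termVal S (fun x => termVal S e (f x)) t := by
  induction t with
  | var x => rfl
  | func F ts ih => simp only [termVal, Term.subst, ih]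

theorem elim_eq_termVal_instVar (σ : ℕ → L.Term ℕ) {n : ℕ} (β : Fin n → S.U) :
    (fun z => termVal S (Sum.elim α β) (instVar σ z)) =
      Sum.elim (fun x => termVal S α (σ x)) β := by
  ext (x | i)
  · simp only [instVar, termVal_relabel, Sum.elim_comp_inl, Sum.elim_inl]
  · rfl

theorem eval_inst (σ : ℕ → L.Term ℕ) {n : ℕ} (β : Fin n → S.U) (A : PreFormula L n) :
    eval S α β (A.inst σ) = eval S (fun x => termVal S α (σ x)) β A := by
  induction A with
  | falsum => rfl
  | pred | equal => simp only [inst, eval, termVal_subst, elim_eq_termVal_instVar]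
  | neg _ ih | all _ ih | ex _ ih => simp only [inst, eval, ih]
  | conj _ _ ih₁ ih₂ | disj _ _ ih₁ ih₂ | impl _ _ ih₁ ih₂ => simp only [inst, eval, ih₁, ih₂]

theorem interp_subst (S : Struc.{u, v, w} L) (α : ℕ → S.U) (x : ℕ) (t : L.Term ℕ)
    (A : Formula L) :
    interp S α (A.subst x t) = interp S (Function.update α x (termVal S α t)) A := by
  rw [interp, subst_eq_inst, eval_inst, interp]
  congr 1
  ext z
  obtain rfl | hz := eq_or_ne z x <;> simp [termVal, *]

theorem interp_update_of_notMem_free (hx : x ∉ A.free) (d : S.U) :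
    interp S (Function.update α x d) A = interp S α A := by
  -- `A` is `[x := x + 1] A`, whose value does not depend on that of `x`.
  have swap (β : ℕ → S.U) : interp S β A = interp S (Function.update β x (β (x + 1))) A := by
    conv_lhs => rw [← subst_of_notMem_free hx (Term.var (x + 1)), interp_subst, termVal]
  rw [swap α, swap (Function.update α x d), Function.update_idem,
    Function.update_of_ne x.succ_ne_self]

theorem interp_atom {k : ℕ} (P : L.Relations k) (ts : Fin k → L.Term ℕ) :
    interp S α (atom P ts) = S.pred P fun i => termVal S α (ts i) := by
  simp only [interp, atom, eval, termVal_relabel, Sum.elim_comp_inl]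

theorem interp_eq (t₁ t₂ : L.Term ℕ) :
    interp S α (Formula.eq t₁ t₂) = S.eq (termVal S α t₁) (termVal S α t₂) := by
  simp only [interp, Formula.eq, eval, termVal_relabel, Sum.elim_comp_inl]

theorem Struc.eq_ne_ff {d d' : S.U} : S.eq d d' ≠ TruthValue.ff ↔ d = d' := by
  refine ⟨fun h => by_contra fun hne => h (S.eq_ne d d' hne), ?_⟩
  rintro rfl
  exact TruthValue.ne_ff_iff.2 (S.eq_self d)

/-- The set of formulas true or both in `S` under the assignment `α`. -/
def theory (S : Struc.{u, v, w} L) (α : ℕ → S.U) : Set (Formula L) :=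
  {A | interp S α A ≠ TruthValue.ff}

theorem mem_theory : A ∈ theory S α ↔ interp S α A ≠ TruthValue.ff := Iff.rfl

theorem falsum_notMem_theory : falsum ∉ theory S α := fun h => h rfl

theorem neg_mem_theory : neg A ∈ theory S α ↔ interp S α A ≠ TruthValue.tt :=
  TruthValue.neg_eq_ff.not

theorem conj_mem_theory : conj A₁ A₂ ∈ theory S α ↔ A₁ ∈ theory S α ∧ A₂ ∈ theory S α :=
  TruthValue.conj_eq_ff.not.trans not_or

theorem disj_mem_theory : disj A₁ A₂ ∈ theory S α ↔ A₁ ∈ theory S α ∨ A₂ ∈ theory S α :=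
  TruthValue.disj_eq_ff.not.trans not_and_or

theorem impl_mem_theory : impl A₁ A₂ ∈ theory S α ↔ (A₁ ∈ theory S α → A₂ ∈ theory S α) :=
  TruthValue.impl_eq_ff.not.trans not_and

theorem forall_mem_theory :
    forall_ x A ∈ theory S α ↔ ∀ d, A ∈ theory S (Function.update α x d) := by
  simp only [mem_theory, interp_forall, Ne, TruthValue.all_eq_ff, not_exists]

theorem exists_mem_theory :
    exists_ x A ∈ theory S α ↔ ∃ d, A ∈ theory S (Function.update α x d) := by
  have := S.nonempty
  simp only [mem_theory, interp_exists, Ne, TruthValue.ex_eq_ff, not_forall]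

theorem eq_mem_theory : Formula.eq t₁ t₂ ∈ theory S α ↔ termVal S α t₁ = termVal S α t₂ := by
  rw [mem_theory, interp_eq, Struc.eq_ne_ff]

theorem subst_mem_theory :
    A.subst x t ∈ theory S α ↔ A ∈ theory S (Function.update α x (termVal S α t)) := by
  rw [mem_theory, interp_subst, mem_theory]

theorem mem_theory_update (hx : x ∉ A.free) (d : S.U) :
    A ∈ theory S (Function.update α x d) ↔ A ∈ theory S α := by
  rw [mem_theory, interp_update_of_notMem_free hx, mem_theory]

-- The two sides can differ in value: if `A₁` is both and `A₂` is false, then `¬(A₁ → A₂)` is true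
-- and `A₁ ∧ ¬A₂` is both.
theorem DeMorgan.mem_theory_iff (h : DeMorgan B B') : B ∈ theory S α ↔ B' ∈ theory S α := by
  cases h with
  | neg A => exact neg_mem_theory.trans TruthValue.neg_eq_tt.not
  | conj A₁ A₂ =>
    simp only [disj_mem_theory, neg_mem_theory, interp, eval, Ne, TruthValue.conj_eq_tt, not_and_or]
  | disj A₁ A₂ =>
    simp only [conj_mem_theory, neg_mem_theory, interp, eval, Ne, TruthValue.disj_eq_tt, not_or]
  | impl A₁ A₂ =>
    rw [conj_mem_theory, neg_mem_theory, neg_mem_theory]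
    simp only [mem_theory, interp, eval, Ne, TruthValue.impl_eq_tt, not_or]
  | forall_ x A =>
    simp only [exists_mem_theory, neg_mem_theory, interp_forall, Ne, TruthValue.all_eq_tt,
      not_forall]
  | exists_ x A =>
    simp only [forall_mem_theory, neg_mem_theory, interp_exists, Ne, TruthValue.ex_eq_tt,
      not_exists]

/-- The formula on the right of `s` holds wherever those on the left hold in `S`. -/
def Valid (S : Struc.{u, v, w} L) (s : Sequent L) : Prop :=
  ∀ α : ℕ → S.U, ↑s.left ⊆ theory S α → s.right ∈ theory S α

theorem lcon_iff_valid {Γ : Finset (Formula L)} :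
    LCon.{u, v, w} Γ A ↔ ∀ S : Struc.{u, v, w} L, Valid S (Γ ⊢ₛ A) := by
  refine forall₂_congr fun S α => ?_
  rw [← TruthValue.ne_ff_iff, or_iff_not_imp_left]
  simp only [not_exists, not_and]
  rfl

end Semantics

section Soundness

variable {S : Struc.{u, v, w} L} {x : ℕ} {A A₁ A₂ B B' : Formula L} {t t₁ t₂ : L.Term ℕ}
  {Γ : Finset (Formula L)} {α : ℕ → S.U}

theorem subset_theory_update (hx : x ∉ freeVars Γ) (hΓ : ↑Γ ⊆ theory S α) (d : S.U) :
    ↑Γ ⊆ theory S (Function.update α x d) := fun _ hB =>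
  (mem_theory_update (fun hxB => hx (Set.mem_biUnion hB hxB)) d).2 (hΓ hB)

namespace Valid

theorem mem_of_insert (h : Valid S (insert B Γ ⊢ₛ A)) (hΓ : ↑Γ ⊆ theory S α)
    (hB : B ∈ theory S α) : A ∈ theory S α :=
  h α <| by simpa only [Finset.coe_insert, Set.insert_subset_iff] using ⟨hB, hΓ⟩

theorem forallI (hx : x ∉ freeVars Γ) (h : Valid S (Γ ⊢ₛ A)) : Valid S (Γ ⊢ₛ forall_ x A) :=
  fun _ hΓ => forall_mem_theory.2 fun d => h _ (subset_theory_update hx hΓ d)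

theorem existsE (hx : x ∉ freeVars (Γ ∪ {A₂})) (h₁ : Valid S (Γ ⊢ₛ exists_ x A₁))
    (h₂ : Valid S (insert A₁ Γ ⊢ₛ A₂)) : Valid S (Γ ⊢ₛ A₂) := fun α hΓ => by
  obtain ⟨d, hd⟩ := exists_mem_theory.1 (h₁ α hΓ)
  simp only [freeVars, Finset.mem_union, Finset.mem_singleton, Set.mem_iUnion₂, not_exists] at hx
  have hxΓ : x ∉ freeVars Γ := by simpa [freeVars] using fun B hB => hx B (.inl hB)
  rw [← mem_theory_update (hx A₂ (.inr rfl)) d]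
  exact h₂.mem_of_insert (subset_theory_update hxΓ hΓ d) hd

theorem eqE (h₁ : Valid S (Γ ⊢ₛ Formula.eq t₁ t₂)) (h₂ : Valid S (Γ ⊢ₛ A.subst x t₁)) :
    Valid S (Γ ⊢ₛ A.subst x t₂) := fun α hΓ => by
  have := h₂ α hΓ
  rwa [subst_mem_theory, eq_mem_theory.1 (h₁ α hΓ), ← subst_mem_theory] at this

theorem deMorgan (h : DeMorgan B B') : Valid S (Γ ⊢ₛ B) ↔ Valid S (Γ ⊢ₛ B') :=
  forall₂_congr fun _ _ => h.mem_theory_iff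

theorem rule {ps : List (Sequent L)} {s : Sequent L} (hr : Rule ps s) (hp : ∀ p ∈ ps, Valid S p) :
    Valid S s := by
  cases hr <;> simp only [List.mem_cons, List.not_mem_nil, forall_eq_or_imp, IsEmpty.forall_iff,
    implies_true, and_true] at hp
  case ident => exact fun _ hΓ => hΓ (Finset.mem_insert_self ..)
  case trueI => exact fun _ _ => neg_mem_theory.2 nofun
  case em A =>
    exact fun _ _ => disj_mem_theory.2 <| or_iff_not_imp_left.2 fun hA =>
      neg_mem_theory.2 fun htt => hA (mem_theory.2 (htt ▸ nofun))
  case falseE => exact fun α hΓ => (falsum_notMem_theory (hp α hΓ)).elim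
  case conjI => exact fun α hΓ => conj_mem_theory.2 ⟨hp.1 α hΓ, hp.2 α hΓ⟩
  case conjE₁ => exact fun α hΓ => (conj_mem_theory.1 (hp α hΓ)).1
  case conjE₂ => exact fun α hΓ => (conj_mem_theory.1 (hp α hΓ)).2
  case disjI₁ => exact fun α hΓ => disj_mem_theory.2 (.inl (hp α hΓ))
  case disjI₂ => exact fun α hΓ => disj_mem_theory.2 (.inr (hp α hΓ))
  case disjE =>
    exact fun α hΓ => (disj_mem_theory.1 (hp.1 α hΓ)).elim (hp.2.1.mem_of_insert hΓ)
      (hp.2.2.mem_of_insert hΓ)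
  case implI => exact fun α hΓ => impl_mem_theory.2 (hp.mem_of_insert hΓ)
  case implE => exact fun α hΓ => impl_mem_theory.1 (hp.1 α hΓ) (hp.2 α hΓ)
  case forallI hx => exact hp.forallI hx
  case forallE => exact fun α hΓ => subst_mem_theory.2 (forall_mem_theory.1 (hp α hΓ) _)
  case existsI => exact fun α hΓ => exists_mem_theory.2 ⟨_, subst_mem_theory.1 (hp α hΓ)⟩
  case existsE hx => exact hp.1.existsE hx hp.2
  case eqI => exact fun _ _ => eq_mem_theory.2 rfl
  case eqE => exact hp.1.eqE hp.2
  case negM => exact (deMorgan (.neg _)).1 hp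
  case negM' => exact (deMorgan (.neg _)).2 hp
  case conjM => exact (deMorgan (.conj ..)).1 hp
  case conjM' => exact (deMorgan (.conj ..)).2 hp
  case disjM => exact (deMorgan (.disj ..)).1 hp
  case disjM' => exact (deMorgan (.disj ..)).2 hp
  case implM => exact (deMorgan (.impl ..)).1 hp
  case implM' => exact (deMorgan (.impl ..)).2 hp
  case forallM => exact (deMorgan (.forall_ ..)).1 hp
  case forallM' => exact (deMorgan (.forall_ ..)).2 hp
  case existsM => exact (deMorgan (.exists_ ..)).1 hp
  case existsM' => exact (deMorgan (.exists_ ..)).2 hp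

end Valid

theorem Derivable.valid {s : Sequent L} (h : Derivable s) (S : Struc.{u, v, w} L) : Valid S s := by
  induction h with
  | rule hr _ ih => exact .rule hr ih

end Soundness

/-! ### Saturated sets -/

section Saturation

variable {Δ Θ : Set (Formula L)} {Γ : Finset (Formula L)} {A A₁ A₂ B B' C : Formula L} {x : ℕ}

/-- A deductively closed consistent set that decides its disjunctions and has witnesses for its
existential formulas; these are the theories of the structures in which every element is the value
of a term. -/
structure Saturated (Δ : Set (Formula L)) : Prop where
  mem_of_derivable {Γ : Finset (Formula L)} {A : Formula L} :
    ↑Γ ⊆ Δ → Derivable (Γ ⊢ₛ A) → A ∈ Δ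
  falsum_notMem : falsum ∉ Δ
  prime {A₁ A₂ : Formula L} : disj A₁ A₂ ∈ Δ → A₁ ∈ Δ ∨ A₂ ∈ Δ
  witness {x : ℕ} {A : Formula L} : exists_ x A ∈ Δ → ∃ t, A.subst x t ∈ Δ

theorem saturated_theory {S : Struc.{u, v, w} L} {α : ℕ → S.U}
    (hα : Function.Surjective (termVal S α)) : Saturated (theory S α) where
  mem_of_derivable hΓ h := h.valid S α hΓ
  falsum_notMem := falsum_notMem_theory
  prime := disj_mem_theory.1
  witness h := by
    obtain ⟨d, hd⟩ := exists_mem_theory.1 h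
    obtain ⟨t, rfl⟩ := hα d
    exact ⟨t, subst_mem_theory.2 hd⟩

theorem derivable_drinker (x : ℕ) (A : Formula L) :
    Derivable (∅ ⊢ₛ exists_ x (impl A (forall_ x A))) := by
  let D : Formula L := exists_ x (impl A (forall_ x A))
  have hx : x ∉ freeVars {neg D} := by
    rw [freeVars, Finset.set_biUnion_singleton]
    exact notMem_free_close x _
  have hneg : Derivable ({neg D} ⊢ₛ neg (impl A (forall_ x A))) := by
    rw [← subst_var_self x (neg (impl A (forall_ x A)))]
    exact .unary (.forallE ..) (.unary (.existsM ..) (.of_mem (Finset.mem_singleton_self _)))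
  have hforall : Derivable ({neg D} ⊢ₛ forall_ x A) :=
    .unary (.forallI _ x A hx) (.unary (.conjE₁ ..) (.unary (.implM ..) hneg))
  have hD : Derivable ({neg D} ⊢ₛ D) := by
    refine .unary (.existsI _ x (Term.var x) _) ?_
    rw [subst_var_self]
    exact .unary (.implI ..) (hforall.weaken (Finset.subset_insert ..))
  exact .ternary (.disjE _ D (neg D) D) (.nullary (.em ..)) (.of_mem (by simp)) hD

namespace Saturated

theorem of_nullary (hΔ : Saturated Δ) (hr : ∀ Γ, Rule [] (Γ ⊢ₛ A)) : A ∈ Δ :=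
  hΔ.mem_of_derivable (Γ := ∅) (by simp) (.nullary (hr _))

theorem of_unary (hΔ : Saturated Δ) (hr : ∀ Γ, Rule [Γ ⊢ₛ A] (Γ ⊢ₛ B)) (hA : A ∈ Δ) : B ∈ Δ :=
  hΔ.mem_of_derivable (Γ := {A}) (by simpa) (.unary (hr _) (.of_mem (by simp)))

theorem of_binary (hΔ : Saturated Δ) (hr : ∀ Γ, Rule [Γ ⊢ₛ A₁, Γ ⊢ₛ A₂] (Γ ⊢ₛ B)) (h₁ : A₁ ∈ Δ)
    (h₂ : A₂ ∈ Δ) : B ∈ Δ :=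
  hΔ.mem_of_derivable (Γ := {A₁, A₂}) (by simp [Set.insert_subset_iff, h₁, h₂])
    (.binary (hr _) (.of_mem (by simp)) (.of_mem (by simp)))

theorem mem_or_neg_mem (hΔ : Saturated Δ) (A : Formula L) : A ∈ Δ ∨ neg A ∈ Δ :=
  hΔ.prime (hΔ.of_nullary (.em · A))

theorem deMorgan_mem_iff (hΔ : Saturated Δ) (h : DeMorgan B B') : B ∈ Δ ↔ B' ∈ Δ :=
  ⟨fun hB => hΔ.mem_of_derivable (Γ := {B}) (by simpa) (h.derivable_iff.1 (.of_mem (by simp))),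
    fun hB' => hΔ.mem_of_derivable (Γ := {B'}) (by simpa)
      (h.derivable_iff.2 (.of_mem (by simp)))⟩

theorem conj_mem_iff (hΔ : Saturated Δ) : conj A₁ A₂ ∈ Δ ↔ A₁ ∈ Δ ∧ A₂ ∈ Δ :=
  ⟨fun h => ⟨hΔ.of_unary (.conjE₁ · _ _) h, hΔ.of_unary (.conjE₂ · _ _) h⟩,
    fun h => hΔ.of_binary (.conjI · _ _) h.1 h.2⟩

theorem disj_mem_iff (hΔ : Saturated Δ) : disj A₁ A₂ ∈ Δ ↔ A₁ ∈ Δ ∨ A₂ ∈ Δ :=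
  ⟨hΔ.prime, fun h => h.elim (hΔ.of_unary (.disjI₁ · _ _)) (hΔ.of_unary (.disjI₂ · _ _))⟩

theorem impl_mem_iff (hΔ : Saturated Δ) : impl A₁ A₂ ∈ Δ ↔ (A₁ ∈ Δ → A₂ ∈ Δ) := by
  refine ⟨hΔ.of_binary (.implE · _ _), fun h => ?_⟩
  obtain himpl | hneg := hΔ.mem_or_neg_mem (impl A₁ A₂)
  · exact himpl
  · have hA₂ : A₂ ∈ Δ := h (hΔ.conj_mem_iff.1 ((hΔ.deMorgan_mem_iff (.impl ..)).1 hneg)).1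
    exact hΔ.mem_of_derivable (Γ := {A₂}) (by simpa) (.unary (.implI ..) (.of_mem (by simp)))

theorem exists_mem_iff (hΔ : Saturated Δ) : exists_ x A ∈ Δ ↔ ∃ t, A.subst x t ∈ Δ :=
  ⟨hΔ.witness, fun ⟨_, ht⟩ => hΔ.of_unary (.existsI · _ _ _) ht⟩

theorem forall_mem_iff (hΔ : Saturated Δ) : forall_ x A ∈ Δ ↔ ∀ t, A.subst x t ∈ Δ := by
  refine ⟨fun h t => hΔ.of_unary (.forallE · _ _ _) h, fun h => ?_⟩
  -- A witness of `∃ x, ¬A` would be of no use: both `A` and `¬A` can be in `Δ`.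
  obtain ⟨t, ht⟩ := hΔ.witness (hΔ.mem_of_derivable (by simp) (derivable_drinker x A))
  have hsubst : (forall_ x A).subst x t = forall_ x A :=
    subst_of_notMem_free (A := forall_ x A) (notMem_free_close x A) t
  rw [PreFormula.subst, hsubst, hΔ.impl_mem_iff] at ht
  exact ht (h t)

end Saturated

/-- `Δ` and `Θ` contain the same ones of the formulas `A` and `¬A`, hence assign the same truth
value to `A`. -/
def Agree (Δ Θ : Set (Formula L)) (A : Formula L) : Prop :=
  (A ∈ Δ ↔ A ∈ Θ) ∧ (neg A ∈ Δ ↔ neg A ∈ Θ)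

theorem Saturated.ext (hΔ : Saturated Δ) (hΘ : Saturated Θ)
    (hatom : ∀ {k : ℕ} (P : L.Relations k) (ts : Fin k → L.Term ℕ), Agree Δ Θ (atom P ts))
    (heq : ∀ t₁ t₂ : L.Term ℕ, Agree Δ Θ (Formula.eq t₁ t₂)) : Δ = Θ := by
  suffices h : ∀ A, Agree Δ Θ A from Set.ext fun A => (h A).1
  intro A
  induction A using Formula.induction with
  | falsum =>
    exact ⟨iff_of_false hΔ.falsum_notMem hΘ.falsum_notMem,
      iff_of_true (hΔ.of_nullary .trueI) (hΘ.of_nullary .trueI)⟩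
  | atom P ts => exact hatom P ts
  | eq t₁ t₂ => exact heq t₁ t₂
  | neg A ih =>
    refine ⟨ih.2, ?_⟩
    rw [hΔ.deMorgan_mem_iff (.neg A), hΘ.deMorgan_mem_iff (.neg A), ih.1]
  | conj A₁ A₂ ih₁ ih₂ =>
    simp only [Agree, hΔ.deMorgan_mem_iff (.conj ..), hΘ.deMorgan_mem_iff (.conj ..),
      hΔ.conj_mem_iff, hΘ.conj_mem_iff, hΔ.disj_mem_iff, hΘ.disj_mem_iff, ih₁.1, ih₁.2, ih₂.1,
      ih₂.2, and_self]
  | disj A₁ A₂ ih₁ ih₂ =>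
    simp only [Agree, hΔ.deMorgan_mem_iff (.disj ..), hΘ.deMorgan_mem_iff (.disj ..),
      hΔ.conj_mem_iff, hΘ.conj_mem_iff, hΔ.disj_mem_iff, hΘ.disj_mem_iff, ih₁.1, ih₁.2, ih₂.1,
      ih₂.2, and_self]
  | impl A₁ A₂ ih₁ ih₂ =>
    simp only [Agree, hΔ.deMorgan_mem_iff (.impl ..), hΘ.deMorgan_mem_iff (.impl ..),
      hΔ.impl_mem_iff, hΘ.impl_mem_iff, hΔ.conj_mem_iff, hΘ.conj_mem_iff, ih₁.1, ih₂.1, ih₂.2,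
      and_self]
  | forall_ x A ih =>
    simp only [Agree, hΔ.deMorgan_mem_iff (.forall_ ..), hΘ.deMorgan_mem_iff (.forall_ ..),
      hΔ.forall_mem_iff, hΘ.forall_mem_iff, hΔ.exists_mem_iff, hΘ.exists_mem_iff,
      PreFormula.subst, (ih _).1, (ih _).2, and_self]
  | exists_ x A ih =>
    simp only [Agree, hΔ.deMorgan_mem_iff (.exists_ ..), hΘ.deMorgan_mem_iff (.exists_ ..),
      hΔ.forall_mem_iff, hΘ.forall_mem_iff, hΔ.exists_mem_iff, hΘ.exists_mem_iff,
      PreFormula.subst, (ih _).1, (ih _).2, and_self]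

theorem saturated_of_maximal (hC : ∀ Γ : Finset (Formula L), ↑Γ ⊆ Δ → ¬Derivable (Γ ⊢ₛ C))
    (hmax : ∀ A ∉ Δ, ∃ Γ : Finset (Formula L), ↑Γ ⊆ Δ ∧ Derivable (insert A Γ ⊢ₛ C))
    (hwitness : ∀ x A, exists_ x A ∈ Δ → ∃ t, A.subst x t ∈ Δ) : Saturated Δ where
  mem_of_derivable {Γ A} hΓ h := by
    by_contra hA
    obtain ⟨Γ', hΓ', h'⟩ := hmax A hA
    refine hC (Γ ∪ Γ') (by simp [hΓ, hΓ']) ((h.weaken ?_).cut (h'.weaken ?_)) <;> grind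
  falsum_notMem h := hC {falsum} (by simpa) (.unary (.falseE ..) (.of_mem (by simp)))
  prime {A₁ A₂} h := by
    by_contra! hA
    obtain ⟨Γ₁, hΓ₁, h₁⟩ := hmax A₁ hA.1
    obtain ⟨Γ₂, hΓ₂, h₂⟩ := hmax A₂ hA.2
    refine hC (insert (disj A₁ A₂) (Γ₁ ∪ Γ₂)) (by simp [Set.insert_subset_iff, h, hΓ₁, hΓ₂])
      (.ternary (.disjE _ A₁ A₂ C) (.of_mem (by simp)) (h₁.weaken ?_) (h₂.weaken ?_)) <;> grind
  witness := hwitness _ _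

/-- The finite sets of formulas from which `C` is not derivable, ordered by inclusion. -/
abbrev Omitting (C : Formula L) := {Γ : Finset (Formula L) // ¬Derivable (Γ ⊢ₛ C)}

theorem isCofinal_decided (A C : Formula L) :
    IsCofinal {Γ : Omitting C | A ∈ Γ.1 ∨ Derivable (insert A Γ.1 ⊢ₛ C)} := fun Γ => by
  by_cases h : Derivable (insert A Γ.1 ⊢ₛ C)
  · exact ⟨Γ, .inr h, le_rfl⟩
  · exact ⟨⟨_, h⟩, .inl (Finset.mem_insert_self ..), Finset.subset_insert ..⟩

theorem Derivable.of_exists_mem_of_insert_subst {y : ℕ} (hA : exists_ x A ∈ Γ)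
    (hy : y ∉ freeVars (Γ ∪ {C})) (hyA : y ∉ A.free)
    (h : Derivable (insert (A.subst x (Term.var y)) Γ ⊢ₛ C)) : Derivable (Γ ⊢ₛ C) := by
  refine .binary (.existsE Γ y _ C hy) (.of_mem ?_) h
  rwa [exists_, close_subst_var hyA]

theorem isCofinal_witnessed (x : ℕ) (A C : Formula L) :
    IsCofinal {Γ : Omitting C | (∃ t, A.subst x t ∈ Γ.1) ∨
      Derivable (insert (exists_ x A) Γ.1 ⊢ₛ C)} := fun Γ => by
  by_cases h : Derivable (insert (exists_ x A) Γ.1 ⊢ₛ C)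
  · exact ⟨Γ, .inr h, le_rfl⟩
  obtain ⟨y, hy⟩ :=
    ((finite_freeVars (insert (exists_ x A) Γ.1 ∪ {C})).union A.finite_free).exists_notMem
  have hy' := fun h' => h (.of_exists_mem_of_insert_subst (Finset.mem_insert_self ..)
    (fun hΓ => hy (.inl hΓ)) (fun hA => hy (.inr hA)) h')
  exact ⟨⟨_, hy'⟩, .inl ⟨_, Finset.mem_insert_self ..⟩,
    (Finset.subset_insert ..).trans (Finset.subset_insert ..)⟩

theorem exists_saturated [∀ n, Countable (L.Functions n)] [∀ n, Countable (L.Relations n)]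
    (h : ¬Derivable (Γ ⊢ₛ C)) : ∃ Δ, ↑Γ ⊆ Δ ∧ C ∉ Δ ∧ Saturated Δ := by
  have := Encodable.ofCountable (Formula L ⊕ ℕ × Formula L)
  let 𝒟 : Formula L ⊕ ℕ × Formula L → Order.Cofinal (Omitting C) := Sum.elim
    (fun A => ⟨_, isCofinal_decided A C⟩) fun p => ⟨_, isCofinal_witnessed p.1 p.2 C⟩
  let I := Order.idealOfCofinals ⟨Γ, h⟩ 𝒟
  let Δ : Set (Formula L) := ⋃ Γ ∈ I, ↑Γ.1
  have subset {Γ : Omitting C} (hΓ : Γ ∈ I) : ↑Γ.1 ⊆ Δ :=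
    Set.subset_biUnion_of_mem (u := fun Γ : Omitting C => (↑Γ.1 : Set (Formula L))) hΓ
  have omits (Γ : Finset (Formula L)) (hΓ : ↑Γ ⊆ Δ) : ¬Derivable (Γ ⊢ₛ C) := by
    obtain ⟨Γ', -, hΓ'⟩ :=
      DirectedOn.exists_mem_subset_of_finset_subset_biUnion I.nonempty I.directed hΓ
    exact fun hder => Γ'.2 (hder.weaken hΓ')
  refine ⟨Δ, subset (Order.mem_idealOfCofinals ..), fun hC => ?_,
    saturated_of_maximal omits (fun A hA => ?_) fun x A hA => ?_⟩
  · exact omits {C} (by simpa) (.of_mem (by simp))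
  · obtain ⟨Γ', hΓ', hI⟩ := Order.cofinal_meets_idealOfCofinals ⟨Γ, h⟩ 𝒟 (.inl A)
    exact ⟨Γ'.1, subset hI, hΓ'.resolve_left fun hA' => hA (subset hI hA')⟩
  · obtain ⟨Γ', ⟨t, ht⟩ | hΓ', hI⟩ := Order.cofinal_meets_idealOfCofinals ⟨Γ, h⟩ 𝒟 (.inr (x, A))
    · exact ⟨t, subset hI ht⟩
    · exact (omits _ (by simpa [Set.insert_subset_iff] using ⟨hA, subset hI⟩) hΓ').elim

end Saturation

/-! ### The term model -/

theorem atom_inst_extend {k : ℕ} (P : L.Relations k) (ts : Fin k → L.Term ℕ) :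
    (atom P fun i => Term.var i.val).inst (Function.extend Fin.val ts Term.var) = atom P ts := by
  simp only [atom, PreFormula.inst, Term.relabel, Term.subst, instVar,
    Fin.val_injective.extend_apply]

theorem eq_inst_extend (t₁ t₂ : L.Term ℕ) :
    (Formula.eq (Term.var 0) (Term.var 1)).inst
      (Function.extend (Fin.val : Fin 2 → ℕ) ![t₁, t₂] Term.var) = Formula.eq t₁ t₂ := by
  rw [eq_inst]
  exact congrArg₂ _ (Fin.val_injective.extend_apply _ _ 0) (Fin.val_injective.extend_apply _ _ 1)

namespace Saturated

variable {Δ : Set (Formula L)} {A : Formula L} {σ τ : ℕ → L.Term ℕ}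
  {s s₁ s₂ t t₁ t₂ : L.Term ℕ}

theorem inst_update_mem (hΔ : Saturated Δ) {x : ℕ} (h : Formula.eq (σ x) t ∈ Δ)
    (hA : A.inst σ ∈ Δ) : A.inst (Function.update σ x t) ∈ Δ := by
  obtain ⟨y, -, hy⟩ := exists_fresh σ ∅ x A
  rw [← Function.update_eq_self x σ, ← inst_update_subst hy] at hA
  rw [← inst_update_subst hy]
  exact hΔ.of_binary (.eqE · y _ _ _) h hA

theorem inst_mem (hΔ : Saturated Δ) (h : ∀ x, Formula.eq (σ x) (τ x) ∈ Δ) (hA : A.inst σ ∈ Δ) :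
    A.inst τ ∈ Δ := by
  have piecewise_mem (X : Finset ℕ) : A.inst (X.piecewise τ σ) ∈ Δ := by
    induction X using Finset.induction with
    | empty => rwa [Finset.piecewise_empty]
    | insert x X hx ih =>
      rw [Finset.piecewise_insert]
      exact hΔ.inst_update_mem (by simpa only [X.piecewise_eq_of_notMem _ _ hx] using h x) ih
  have free_piecewise : A.inst (A.finite_free.toFinset.piecewise τ σ) = A.inst τ :=
    inst_congr fun z hz => Finset.piecewise_eq_of_mem _ _ _ (A.finite_free.mem_toFinset.2 hz)
  exact free_piecewise ▸ piecewise_mem _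

theorem eq_self_mem (hΔ : Saturated Δ) (t : L.Term ℕ) : Formula.eq t t ∈ Δ :=
  hΔ.of_nullary (.eqI · t)

theorem eq_extend_mem (hΔ : Saturated Δ) {k : ℕ} {ss ts : Fin k → L.Term ℕ}
    (h : ∀ i, Formula.eq (ss i) (ts i) ∈ Δ) (x : ℕ) :
    Formula.eq (Function.extend Fin.val ss Term.var x) (Function.extend Fin.val ts Term.var x) ∈
      Δ := by
  by_cases hx : ∃ i : Fin k, i.val = x
  · obtain ⟨i, rfl⟩ := hx
    simpa only [Fin.val_injective.extend_apply] using h i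
  · simpa only [Function.extend_apply' _ _ _ hx] using hΔ.eq_self_mem _

theorem eq_mem_congr (hΔ : Saturated Δ) (h₁ : Formula.eq s₁ t₁ ∈ Δ) (h₂ : Formula.eq s₂ t₂ ∈ Δ)
    (h : Formula.eq s₁ s₂ ∈ Δ) : Formula.eq t₁ t₂ ∈ Δ := by
  rw [← eq_inst_extend] at h ⊢
  exact hΔ.inst_mem (hΔ.eq_extend_mem (Fin.forall_fin_two.2 ⟨h₁, h₂⟩)) h

theorem eq_symm_mem (hΔ : Saturated Δ) (h : Formula.eq s t ∈ Δ) : Formula.eq t s ∈ Δ :=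
  hΔ.eq_mem_congr h (hΔ.eq_self_mem s) (hΔ.eq_self_mem s)

theorem eq_subst_mem (hΔ : Saturated Δ) (h : ∀ x, Formula.eq (σ x) (τ x) ∈ Δ) (t : L.Term ℕ) :
    Formula.eq (t.subst σ) (t.subst τ) ∈ Δ := by
  let e := Equiv.natSumNatEquivNat
  let B := Formula.eq (t.relabel (e ∘ Sum.inl)) (t.relabel (e ∘ Sum.inr))
  have inst_B (ρ₁ ρ₂ : ℕ → L.Term ℕ) :
      B.inst (Sum.elim ρ₁ ρ₂ ∘ e.symm) = Formula.eq (t.subst ρ₁) (t.subst ρ₂) := by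
    simp only [B, eq_inst, term_relabel_eq_subst, term_subst_subst, Term.subst, Function.comp_apply,
      e.symm_apply_apply, Sum.elim_inl, Sum.elim_inr]
  rw [← inst_B]
  refine hΔ.inst_mem (σ := Sum.elim σ σ ∘ e.symm) (fun x => ?_) ?_
  · simp only [Function.comp_apply]
    cases e.symm x with
    | inl y => exact hΔ.eq_self_mem _
    | inr y => exact h y
  · rw [inst_B]
    exact hΔ.eq_self_mem _

theorem eq_func_mem (hΔ : Saturated Δ) {k : ℕ} (f : L.Functions k) {ss ts : Fin k → L.Term ℕ}
    (h : ∀ i, Formula.eq (ss i) (ts i) ∈ Δ) :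
    Formula.eq (Term.func f ss) (Term.func f ts) ∈ Δ := by
  simpa only [Term.subst, Fin.val_injective.extend_apply] using
    hΔ.eq_subst_mem (hΔ.eq_extend_mem h) (Term.func f fun i => Term.var i.val)

end Saturated

section Value

variable {Δ : Set (Formula L)} {A B : Formula L} {S : Struc.{u, v, w} L} {α : ℕ → S.U}

open Classical in
/-- The truth value that `Δ` assigns to `A`, where `A ∈ Δ` is read as `A` not being false, and
`¬A ∈ Δ` as `A` not being true. -/
noncomputable def value (Δ : Set (Formula L)) (A : Formula L) : TruthValue :=
  if A ∉ Δ then .ff else if neg A ∉ Δ then .tt else .both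

theorem value_ne_ff : value Δ A ≠ .ff ↔ A ∈ Δ := by
  grind [value]

theorem Saturated.value_ne_tt (hΔ : Saturated Δ) : value Δ A ≠ .tt ↔ neg A ∈ Δ := by
  grind [value, hΔ.mem_or_neg_mem A]

theorem value_congr (h : A ∈ Δ ↔ B ∈ Δ) (hneg : neg A ∈ Δ ↔ neg B ∈ Δ) :
    value Δ A = value Δ B := by
  grind [value]

theorem Saturated.value_inst_congr (hΔ : Saturated Δ) {σ τ : ℕ → L.Term ℕ}
    (h : ∀ x, Formula.eq (σ x) (τ x) ∈ Δ) (A : Formula L) :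
    value Δ (A.inst σ) = value Δ (A.inst τ) := by
  have inst_mem_iff (B : Formula L) : B.inst σ ∈ Δ ↔ B.inst τ ∈ Δ :=
    ⟨hΔ.inst_mem h, hΔ.inst_mem fun x => hΔ.eq_symm_mem (h x)⟩
  exact value_congr (inst_mem_iff A) (inst_mem_iff (.neg A))

theorem Saturated.value_atom_congr (hΔ : Saturated Δ) {k : ℕ} (P : L.Relations k)
    {ss ts : Fin k → L.Term ℕ} (h : ∀ i, Formula.eq (ss i) (ts i) ∈ Δ) :
    value Δ (atom P ss) = value Δ (atom P ts) := by
  rw [← atom_inst_extend P ss, ← atom_inst_extend P ts]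
  exact hΔ.value_inst_congr (hΔ.eq_extend_mem h) _

theorem Saturated.value_eq_congr (hΔ : Saturated Δ) {s₁ s₂ t₁ t₂ : L.Term ℕ}
    (h₁ : Formula.eq s₁ t₁ ∈ Δ) (h₂ : Formula.eq s₂ t₂ ∈ Δ) :
    value Δ (Formula.eq s₁ s₂) = value Δ (Formula.eq t₁ t₂) := by
  rw [← eq_inst_extend s₁ s₂, ← eq_inst_extend t₁ t₂]
  exact hΔ.value_inst_congr (hΔ.eq_extend_mem (Fin.forall_fin_two.2 ⟨h₁, h₂⟩)) _

theorem Saturated.agree_theory_of_interp_eq (hΔ : Saturated Δ) (h : interp S α A = value Δ A) :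
    Agree (theory S α) Δ A :=
  ⟨by rw [mem_theory, h, value_ne_ff], by rw [neg_mem_theory, h, hΔ.value_ne_tt]⟩

end Value

namespace Saturated

variable {Δ : Set (Formula L)}

/-- Two terms are equivalent if their equation is in `Δ`. -/
def termSetoid (hΔ : Saturated Δ) : Setoid (L.Term ℕ) where
  r s t := Formula.eq s t ∈ Δ
  iseqv := ⟨hΔ.eq_self_mem, hΔ.eq_symm_mem, fun h₁ h₂ =>
    hΔ.eq_mem_congr (hΔ.eq_self_mem _) h₂ h₁⟩

variable [Small.{w} (L.Term ℕ)]

/-- The elements of the term model: the terms modulo the equations in `Δ`, moved to an arbitrary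
universe. -/
abbrev TermClass (hΔ : Saturated Δ) : Type w := Shrink.{w} (Quotient hΔ.termSetoid)

/-- The class of a term. -/
noncomputable def cls (hΔ : Saturated Δ) (t : L.Term ℕ) : TermClass.{u, v, w} hΔ :=
  equivShrink _ ⟦t⟧

/-- A term that represents the given class. -/
noncomputable def rep (hΔ : Saturated Δ) (d : TermClass.{u, v, w} hΔ) : L.Term ℕ :=
  ((equivShrink _).symm d).out

theorem cls_rep (hΔ : Saturated Δ) (d : TermClass.{u, v, w} hΔ) : hΔ.cls (hΔ.rep d) = d := by
  simp only [cls, rep, Quotient.out_eq, Equiv.apply_symm_apply]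

theorem cls_eq_cls_iff (hΔ : Saturated Δ) {s t : L.Term ℕ} :
    (hΔ.cls s : TermClass.{u, v, w} hΔ) = hΔ.cls t ↔ Formula.eq s t ∈ Δ := by
  rw [cls, cls, (equivShrink _).apply_eq_iff_eq, Quotient.eq]
  rfl

theorem eq_rep_cls_mem (hΔ : Saturated Δ) (t : L.Term ℕ) :
    Formula.eq (hΔ.rep (hΔ.cls t : TermClass.{u, v, w} hΔ)) t ∈ Δ :=
  hΔ.cls_eq_cls_iff.1 (hΔ.cls_rep _)

/-- The structure of terms modulo the equations in `Δ`, with the truth values that `Δ` assigns to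
atoms and equations. -/
noncomputable def termModel (hΔ : Saturated Δ) : Struc.{u, v, w} L where
  U := TermClass.{u, v, w} hΔ
  nonempty := ⟨hΔ.cls (Term.var 0)⟩
  func f ds := hΔ.cls (Term.func f fun i => hΔ.rep (ds i))
  pred P ds := value Δ (atom P fun i => hΔ.rep (ds i))
  eq d d' := value Δ (Formula.eq (hΔ.rep d) (hΔ.rep d'))
  eq_self d := TruthValue.ne_ff_iff.1 (value_ne_ff.2 (hΔ.eq_self_mem _))
  eq_ne d d' hd := by
    contrapose! hd
    rw [← hΔ.cls_rep d, ← hΔ.cls_rep d', hΔ.cls_eq_cls_iff]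
    exact value_ne_ff.1 hd

/-- The assignment of its class to each variable. -/
noncomputable def canonical (hΔ : Saturated Δ) (x : ℕ) : (termModel.{u, v, w} hΔ).U :=
  hΔ.cls (Term.var x)

theorem termVal_canonical (hΔ : Saturated Δ) (t : L.Term ℕ) :
    termVal (termModel.{u, v, w} hΔ) hΔ.canonical t = hΔ.cls t := by
  induction t with
  | var x => rfl
  | func f ts ih =>
    simp only [termVal, ih]
    exact hΔ.cls_eq_cls_iff.2 (hΔ.eq_func_mem f fun i => hΔ.eq_rep_cls_mem _)

theorem termVal_canonical_surjective (hΔ : Saturated Δ) :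
    Function.Surjective (termVal (termModel.{u, v, w} hΔ) hΔ.canonical) := fun d =>
  ⟨hΔ.rep d, (hΔ.termVal_canonical _).trans (hΔ.cls_rep d)⟩

theorem theory_termModel (hΔ : Saturated Δ) :
    theory (termModel.{u, v, w} hΔ) hΔ.canonical = Δ := by
  refine (saturated_theory hΔ.termVal_canonical_surjective).ext hΔ
    (fun P ts => hΔ.agree_theory_of_interp_eq ?_) fun t₁ t₂ => hΔ.agree_theory_of_interp_eq ?_
  · simp only [interp_atom, hΔ.termVal_canonical]
    exact hΔ.value_atom_congr P fun i => hΔ.eq_rep_cls_mem _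
  · simp only [interp_eq, hΔ.termVal_canonical]
    exact hΔ.value_eq_congr (hΔ.eq_rep_cls_mem _) (hΔ.eq_rep_cls_mem _)

theorem exists_theory_eq (hΔ : Saturated Δ) :
    ∃ (S : Struc.{u, v, w} L) (α : ℕ → S.U), theory S α = Δ :=
  ⟨_, _, hΔ.theory_termModel⟩

end Saturated

end LPif

theorem theorem1_general (L : FirstOrder.Language.{u, v})
    [∀ n, Countable (L.Functions n)] [∀ n, Countable (L.Relations n)]
    (Γ : Finset (LPif.Formula L)) (A : LPif.Formula L) :
    LPif.Provable Γ A ↔ LPif.LCon.{u, v, w} Γ A := by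
  rw [LPif.provable_iff_derivable, LPif.lcon_iff_valid]
  refine ⟨LPif.Derivable.valid, fun hvalid => ?_⟩
  by_contra hA
  obtain ⟨Δ, hΓ, hAΔ, hΔ⟩ := LPif.exists_saturated hA
  obtain ⟨S, α, rfl⟩ := LPif.Saturated.exists_theory_eq.{u, v, w} hΔ
  exact hAΔ (hvalid S α hΓ)

theorem theorem1 (L : FirstOrder.Language.{0, 0})
    [∀ n, Countable (L.Functions n)] [∀ n, Countable (L.Relations n)]
    (Γ : Finset (LPif.Formula L)) (A : LPif.Formula L) :
    LPif.Provable Γ A ↔ LPif.LCon.{0, 0, w} Γ A :=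
  theorem1_general L Γ A
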